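/- Let $H$ be an infinite-dimensional separable complex Hilbert space. Let $\mathcal{BF}^{sa}_*$ be the space, with the operator norm topology, of bounded self-adjoint Fredholm operators $T$ on $H$ that are neither essentially positive nor essentially negative (i.e. the essential spectrum $\operatorname{spec}_{ess}T$ is contained neither in $(0,\infty)$ nor in $(-\infty,0)$), and let $G\mathcal{BF}^{sa}_*$ be the subset of its invertible elements. Let $\Omega(\mathcal{BF}^{sa}_*,G\mathcal{BF}^{sa}_*)$ be the set of continuous paths $f:[0,1]\to\mathcal{BF}^{sa}_*$ with $f(0),f(1)\in G\mathcal{BF}^{sa}_*$. For such a path, choose a subdivision $0=t_0<t_1<\dots<t_n=1$ and numbers $\varepsilon_j>0$ such that for $1\le j\le n$ and $t_{j-1}\le t\le t_j$ one has $\pm\varepsilon_j\notin\operatorname{spec} f(t)$ and $[-\varepsilon_j,\varepsilon_j]\cap\operatorname{spec}_{ess}f(t)=\emptyset$. The spectral flow of $f$ is $$\mathrm{SF}(f)=\sum_{j=1}^n\Bigl(\operatorname{rank}1_{[0,\varepsilon_j)}(f(t_j))-\operatorname{rank}1_{[0,\varepsilon_j)}(f(t_{j-1}))\Bigr);$$ such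 a subdivision always exists and the value does not depend on its choice. Let $\mu:\Omega(\mathcal{BF}^{sa}_*,G\mathcal{BF}^{sa}_*)\to\mathbb Z$ be a map with the following properties. * Concatenation: $\mu(f*g)=\mu(f)+\mu(g)$ whenever $f(1)=g(0)$, where $f*g$ is $f$ followed by $g$. * Homotopy: $\mu(f)=\mu(g)$ whenever there is a continuous map $F:[0,1]\times[0,1]\to\mathcal{BF}^{sa}_*$ with $F(0,\cdot)=f$, $F(1,\cdot)=g$ and $F(s,0),F(s,1)\in G\mathcal{BF}^{sa}_*$ for all $s$. * Normalization: there are a $T_0\in G\mathcal{BF}^{sa}_*$ and a rank one orthogonal projection $P$ commuting with $T_0$ such that the path $f_P(t)=tP+(I-P)T_0$, $-1/2\le t\le 1/2$ (reparametrized by $[0,1]$ via $t\mapsto t-1/2$), satisfies $\mu(f_P)=1$. Then $\mu(f)=\mathrm{SF}(f)$ for every $f\in\Omega(\mathcal{BF}^{sa}_*,G\mathcal{BF}^{sa}_*)$. -/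

import Mathlib

open scoped Topology unitInterval

noncomputable section

namespace SpectralFlow

/-! ### Paths with endpoints in a subspace, and their integer invariants -/

section Paths

variable {X : Type*} [TopologicalSpace X]

/-- `Ω(X, Y)`: continuous paths `[0,1] → X` with both endpoints in `Y`. -/
def Omega (X : Type*) [TopologicalSpace X] (Y : Set X) : Type _ :=
  {f : C(I, X) // f 0 ∈ Y ∧ f 1 ∈ Y}

/-- The concatenation `f * g` of two paths with `f 1 = g 0`: first `f`, then `g`, each at double
speed. -/
def Omega.concat {Y : Set X} (f g : Omega X Y) (h : f.1 1 = g.1 0) : Omega X Y :=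
  ⟨((⟨f.1, rfl, rfl⟩ : Path (f.1 0) (f.1 1)).trans
      (⟨g.1, h.symm, rfl⟩ : Path (f.1 1) (g.1 1))).toContinuousMap, by
    refine ⟨?_, ?_⟩
    · rw [Path.coe_toContinuousMap, Path.source]; exact f.2.1
    · rw [Path.coe_toContinuousMap, Path.target]; exact g.2.2⟩

/-- Free homotopy in `Ω(X, Y)`: the endpoints may move, but only inside `Y`. -/
def Omega.Homotopic {Y : Set X} (f g : Omega X Y) : Prop :=
  ∃ F : C(I × I, X), (∀ t, F (0, t) = f.1 t) ∧ (∀ t, F (1, t) = g.1 t) ∧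
    ∀ s, F (s, 0) ∈ Y ∧ F (s, 1) ∈ Y

/-- *Concatenation*: `μ (f * g) = μ f + μ g` whenever `f 1 = g 0`. -/
def SatisfiesConcatenation {Y : Set X} (μ : Omega X Y → ℤ) : Prop :=
  ∀ (f g : Omega X Y) (h : f.1 1 = g.1 0), μ (f.concat g h) = μ f + μ g

/-- *Homotopy*: `μ` descends to free homotopy classes. -/
def SatisfiesHomotopy {Y : Set X} (μ : Omega X Y → ℤ) : Prop :=
  ∀ f g : Omega X Y, f.Homotopic g → μ f = μ g

end Paths

/-! ### Self-adjoint Fredholm operators -/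

section Operators

variable {H : Type*} [NormedAddCommGroup H] [InnerProductSpace ℂ H]

/-- The real part of the essential spectrum: those real `r` for which `T - r` is not a Fredholm
operator. For self-adjoint `T` this is the whole essential spectrum. -/
def essSpectrum (T : H →L[ℂ] H) : Set ℝ :=
  {r | ¬ (T - (r : ℂ) • (1 : H →L[ℂ] H)).IsFredholm}

/-- `T` is essentially positive: its essential spectrum lies in `(0, ∞)`. -/
def EssentiallyPositive (T : H →L[ℂ] H) : Prop := essSpectrum T ⊆ Set.Ioi 0

/-- `T` is essentially negative: its essential spectrum lies in `(-∞, 0)`. -/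
def EssentiallyNegative (T : H →L[ℂ] H) : Prop := essSpectrum T ⊆ Set.Iio 0

variable [CompleteSpace H]

variable (H) in
/-- The space of bounded self-adjoint Fredholm operators which are neither essentially positive nor
essentially negative, with the operator norm topology. -/
abbrev BFsaStar : Type _ :=
  {T : H →L[ℂ] H // IsSelfAdjoint T ∧ T.IsFredholm ∧
    ¬ EssentiallyPositive T ∧ ¬ EssentiallyNegative T}

variable (H) in
/-- The invertible elements (bounded inverse) of `BFsaStar H`. -/
def GBFsaStar : Set (BFsaStar H) := {T | IsUnit T.1}

/-! ### Spectral flow -/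

/-- `0` is not an accumulation point of the spectrum of a self-adjoint Fredholm operator. -/
theorem eventually_notMem_spectrum {T : H →L[ℂ] H} (hT : IsSelfAdjoint T) (hF : T.IsFredholm) :
    ∀ᶠ r : ℝ in 𝓝[≠] 0, r ∉ spectrum ℝ T := by
  have hsym : ∀ x y, inner ℂ (T x) y = inner ℂ x (T y) := hT.isSymmetric
  set K : Submodule ℂ H := LinearMap.ker (T : H →ₗ[ℂ] H) with hK
  have : FiniteDimensional ℂ K := hF.finite_ker
  have hTK : ∀ x ∈ K, T x = 0 := fun x hx => hx
  have hrange : ∀ y ∈ Kᗮ, ∃ x, T x = y := by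
    intro y hy
    set R : Submodule ℂ H := LinearMap.range (T : H →ₗ[ℂ] H) with hR
    have hcl : IsClosed (R : Set H) := hF.isClosed_range
    have : CompleteSpace R := hcl.completeSpace_coe
    have hRK : Rᗮ ≤ K := by
      intro z hz
      have h1 : inner ℂ (T (T z)) z = 0 := hz (T (T z)) ⟨T z, rfl⟩
      rw [hsym, inner_self_eq_zero] at h1
      exact h1
    have h2 : y ∈ Rᗮᗮ := fun u hu => hy u (hRK hu)
    rw [Submodule.orthogonal_orthogonal] at h2
    exact h2
  set P : H →L[ℂ] H := K.starProjection with hP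
  have hPK : ∀ x, P x ∈ K := fun x => Submodule.starProjection_apply_mem K x
  have hPP : ∀ x ∈ K, P x = x := fun x hx => Submodule.starProjection_eq_self_iff.2 hx
  have hTorth : ∀ x, T x ∈ Kᗮ := by
    intro x u hu
    rw [← hsym, hTK u hu, inner_zero_left]
  have hPO : ∀ x ∈ Kᗮ, P x = 0 := fun x hx =>
    (Submodule.starProjection_apply_eq_zero_iff K).2 hx
  have hsub : ∀ x, x - P x ∈ Kᗮ := fun x => Submodule.sub_starProjection_mem_orthogonal x
  have hTP : T * P = 0 := by
    ext x; exact hTK _ (hPK x)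
  have hPsq : P * P = P := by
    ext x; exact hPP _ (hPK x)
  have hPT : P * T = 0 := by
    ext x; exact hPO _ (hTorth x)
  have hunit : IsUnit (T + P) := by
    rw [ContinuousLinearMap.isUnit_iff_bijective]
    constructor
    · rw [injective_iff_map_eq_zero]
      intro x hx
      have h1 : P x = 0 := by
        have h2 : P ((T + P) x) = (P * T) x + (P * P) x := by simp
        rw [hx, map_zero, hPT, hPsq] at h2
        simpa using h2.symm
      have h3 : T x = 0 := by simpa [h1] using hx
      rw [← hPP x h3, h1]
    · intro y
      obtain ⟨x, hx⟩ := hrange (y - P y) (hsub y)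
      refine ⟨x - P x + P y, ?_⟩
      have e1 : T (P x) = 0 := hTK _ (hPK x)
      have e2 : T (P y) = 0 := hTK _ (hPK y)
      have e3 : P (P x) = P x := hPP _ (hPK x)
      have e4 : P (P y) = P y := hPP _ (hPK y)
      simp [e1, e2, e3, e4, hx]
  have hev : ∀ᶠ r : ℝ in 𝓝 0, IsUnit (T + P - algebraMap ℝ (H →L[ℂ] H) r) := by
    have hc : Continuous fun r : ℝ => T + P - algebraMap ℝ (H →L[ℂ] H) r :=
      continuous_const.sub (continuous_algebraMap ℝ _)
    refine hc.continuousAt.eventually (Units.isOpen.mem_nhds ?_)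
    simpa using hunit
  filter_upwards [hev.filter_mono nhdsWithin_le_nhds, self_mem_nhdsWithin] with r hr hr0
  have hr0 : r ≠ 0 := hr0
  rw [spectrum.notMem_iff, IsUnit.sub_iff, ContinuousLinearMap.isUnit_iff_bijective]
  rw [ContinuousLinearMap.isUnit_iff_bijective] at hr
  have hval : ∀ x, (T - algebraMap ℝ (H →L[ℂ] H) r) x = T x - r • x := by
    intro x; simp [Algebra.algebraMap_eq_smul_one]
  have hval' : ∀ x, (T + P - algebraMap ℝ (H →L[ℂ] H) r) x = T x + P x - r • x := by
    intro x; simp [Algebra.algebraMap_eq_smul_one]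
  have hPr : ∀ x : H, P (r • x) = r • P x := fun x => P.map_smul_of_tower r x
  have hTr : ∀ x : H, T (r • x) = r • T x := fun x => T.map_smul_of_tower r x
  constructor
  · rw [injective_iff_map_eq_zero]
    intro x hx
    rw [hval] at hx
    have h1 : P x = 0 := by
      have h2 : P (T x - r • x) = (P * T) x - r • P x := by
        rw [map_sub, hPr]; rfl
      rw [hx, map_zero, hPT] at h2
      have h3 : r • P x = 0 := by simpa using h2.symm
      exact (smul_eq_zero.1 h3).resolve_left hr0
    apply (injective_iff_map_eq_zero _).1 hr.1
    rw [hval', h1, add_zero, hx]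
  · intro y
    obtain ⟨x, hx⟩ := hr.2 (y - P y)
    rw [hval'] at hx
    refine ⟨x - P x - r⁻¹ • P y, ?_⟩
    have e1 : T (P x) = 0 := hTK _ (hPK x)
    have e2 : T (P y) = 0 := hTK _ (hPK y)
    have e3 : P (P x) = P x := hPP _ (hPK x)
    have e4 : P (P y) = P y := hPP _ (hPK y)
    have e5 : P (T x) = 0 := hPO _ (hTorth x)
    have h4 : P x = r • P x := by
      have h5 := congrArg P hx
      rw [map_sub, map_add, map_sub, e3, e4, e5, hPr, zero_add, sub_self, sub_eq_zero] at h5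
      exact h5
    have e6 : T (r⁻¹ • P y) = 0 := by rw [T.map_smul_of_tower, e2, smul_zero]
    rw [hval, map_sub, map_sub, e1, e6, smul_sub, smul_sub, smul_inv_smul₀ hr0, ← h4, sub_zero,
      sub_zero]
    have : T x = y - P y - P x + r • x := by rw [← hx]; abel
    rw [this]; abel

/-- For a self-adjoint Fredholm operator `T` and `ε ∉ spec T`, the characteristic function of
`[0, ε)` is continuous on the spectrum of `T`. Hence the continuous functional calculus applies to
it, and its value is the Borel functional calculus value `1_{[0, ε)}(T)`. -/
theorem continuousOn_indicator_spectrum {T : H →L[ℂ] H} (hT : IsSelfAdjoint T)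
    (hF : T.IsFredholm) {ε : ℝ} (hε : ε ∉ spectrum ℝ T) :
    ContinuousOn (Set.indicator (Set.Ico 0 ε) (1 : ℝ → ℝ)) (spectrum ℝ T) := by
  intro x hx
  have hne : x ≠ ε := fun h => hε (h ▸ hx)
  have key : ∀ᶠ y in 𝓝[spectrum ℝ T] x,
      Set.indicator (Set.Ico 0 ε) (1 : ℝ → ℝ) y = Set.indicator (Set.Ico 0 ε) (1 : ℝ → ℝ) x := by
    rcases eq_or_ne x 0 with rfl | h0
    · have h1 := eventually_nhdsWithin_iff.1 (eventually_notMem_spectrum hT hF)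
      filter_upwards [h1.filter_mono nhdsWithin_le_nhds, self_mem_nhdsWithin] with y hy hys
      rcases eq_or_ne y 0 with rfl | hy0
      · rfl
      · exact absurd hys (hy hy0)
    · have h1 : ∀ᶠ y in 𝓝 x, (0 ≤ y ↔ 0 ≤ x) := by
        rcases lt_or_gt_of_ne h0 with h | h
        · filter_upwards [eventually_lt_nhds h] with y hy
          exact iff_of_false (not_le.2 hy) (not_le.2 h)
        · filter_upwards [eventually_gt_nhds h] with y hy
          exact iff_of_true hy.le h.le
      have h2 : ∀ᶠ y in 𝓝 x, (y < ε ↔ x < ε) := by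
        rcases lt_or_gt_of_ne hne with h | h
        · filter_upwards [eventually_lt_nhds h] with y hy
          exact iff_of_true hy h
        · filter_upwards [eventually_gt_nhds h] with y hy
          exact iff_of_false (not_lt.2 hy.le) (not_lt.2 h.le)
      filter_upwards [h1.filter_mono nhdsWithin_le_nhds, h2.filter_mono nhdsWithin_le_nhds]
        with y hy1 hy2
      simp only [Set.indicator, Set.mem_Ico, hy1, hy2, Pi.one_apply]
  exact (tendsto_const_nhds.congr' (key.mono fun y hy => hy.symm))

/-- The spectral projection `1_{[0, ε)}(T)`, through the functional calculus. It is only used for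
self-adjoint Fredholm `T` and `ε ∉ spec T`, where the characteristic function is continuous on the
spectrum by `continuousOn_indicator_spectrum`. -/
def spectralProj (T : H →L[ℂ] H) (ε : ℝ) : H →L[ℂ] H :=
  cfc (Set.indicator (Set.Ico 0 ε) (1 : ℝ → ℝ)) T

/-- The rank of `1_{[0, ε)}(T)`. -/
def spectralRank (T : H →L[ℂ] H) (ε : ℝ) : ℕ :=
  Module.finrank ℂ (LinearMap.range (spectralProj T ε : H →ₗ[ℂ] H))

/-- A subdivision `0 = t₀ < ⋯ < tₙ = 1` together with `ε₁, …, εₙ > 0` such that for all `t` in the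
`j`-th interval, `±εⱼ ∉ spec (f t)` and `[-εⱼ, εⱼ] ∩ spec_ess (f t) = ∅`. -/
structure FlowSubdivision (f : C(I, BFsaStar H)) where
  n : ℕ
  t : Fin (n + 1) → I
  strictMono : StrictMono t
  t_zero : t 0 = 0
  t_last : t (Fin.last n) = 1
  ε : Fin n → ℝ
  ε_pos : ∀ j, 0 < ε j
  notMem_spectrum : ∀ j, ∀ s ∈ Set.Icc (t j.castSucc) (t j.succ),
    ε j ∉ spectrum ℝ (f s).1 ∧ -ε j ∉ spectrum ℝ (f s).1
  disjoint_essSpectrum : ∀ j, ∀ s ∈ Set.Icc (t j.castSucc) (t j.succ),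
    Set.Icc (-ε j) (ε j) ∩ essSpectrum (f s).1 = ∅

/-- `∑ⱼ (rank 1_{[0, εⱼ)}(f tⱼ) - rank 1_{[0, εⱼ)}(f tⱼ₋₁))`. -/
def FlowSubdivision.flow {f : C(I, BFsaStar H)} (S : FlowSubdivision f) : ℤ :=
  ∑ j : Fin S.n, ((spectralRank (f (S.t j.succ)).1 (S.ε j) : ℤ) -
    (spectralRank (f (S.t j.castSucc)).1 (S.ε j) : ℤ))

open Classical in
/-- The spectral flow of `f`: the value of `FlowSubdivision.flow` for a chosen subdivision. -/
def spectralFlow (f : C(I, BFsaStar H)) : ℤ :=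
  if h : Nonempty (FlowSubdivision f) then (Classical.choice h).flow else 0

/-! ### Normalization -/

/-- *Normalization*: there are an invertible `T₀` in `BFsaStar H` and an orthogonal projection `P`
of rank one commuting with `T₀` such that `μ` is `1` on the path `t ↦ t P + (1 - P) T₀`,
`-1/2 ≤ t ≤ 1/2`, reparametrized by `[0,1]`. -/
def SatisfiesNormalization (μ : Omega (BFsaStar H) (GBFsaStar H) → ℤ) : Prop :=
  ∃ T₀ ∈ GBFsaStar H, ∃ P : H →L[ℂ] H,
    IsStarProjection P ∧ Module.finrank ℂ (LinearMap.range (P : H →ₗ[ℂ] H)) = 1 ∧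
    Commute P T₀.1 ∧
    ∃ f : Omega (BFsaStar H) (GBFsaStar H),
      (∀ t : I, (f.1 t).1 = (((t : ℝ) - 1 / 2 : ℝ) : ℂ) • P + (1 - P) * T₀.1) ∧ μ f = 1

end Operators

end SpectralFlow

end

/-! The kernel of an operator is counted on the positive side, as the half-open interval `[0, ε)`
demands. For any `T` in `BFsaStar H` the operator `addKer T`, namely `T + 1_{0}(T)`, is invertible
and differs from `T` by finite rank. For a path `f`, let `Φ t` be the value of `μ` on `f` restricted
to `[0, t]` followed by the segment to `addKer (f t)` (`partialFlow`). Then `Φ 0 = 0` and `Φ 1 = μ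
f`, so it suffices to compute the increment of `Φ` over an interval on which one `ε` is admissible.

On such an interval `pushUp`, namely `T + 2ε 1_{(-ε, ε)}(T)`, is invertible and depends continuously
on the parameter. By homotopy invariance, `μ` of the restricted path completed by the segment to
`pushUp` is therefore constant. The two completions differ by the segment from `addKer` to `pushUp`,
which lifts exactly the eigenvalues in `(-ε, 0)` across zero. So `Φ + rank 1_{(-ε, 0)}` is constant.
The rank of `1_{(-ε, ε)}` is constant too, hence `Φ` and `rank 1_{[0, ε)}` have equal increments,
and the sum telescopes (`partialFlow_sub`, `mu_eq_flow`).

What remains is that each simple upward crossing counts `1`, although normalization gives this for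
one crossing only (`mu_crossing_eq_one`). An invertible element of `BFsaStar H` has
infinite-dimensional positive and negative spectral subspaces. In a separable space a unitary
carries the positive subspace and the crossing eigenvector of one path to those of the other, and it
can be written as a product of three reflections, each explicitly joined to the identity.
Conjugating along that path of unitaries makes the positive projections agree. Operators polarized
by the same projection form a convex set of invertible operators, so a straight homotopy finishes.
Crossings of higher multiplicity are split one eigenvector at a time (`mu_seg_eq_finrank`). -/

open scoped Topology unitInterval

noncomputable section

namespace SpectralFlow

/-! ### Finite-rank perturbations, essential spectrum, and finite-rank functional calculus. -/

section Fredholm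

variable {H : Type*} [NormedAddCommGroup H] [InnerProductSpace ℂ H]

open scoped LinearMap.FiniteRangeSetoid

/-- Bounded operators of finite rank. -/
def FinRank (F : H →L[ℂ] H) : Prop := (F : H →ₗ[ℂ] H).HasFiniteRange

theorem FinRank.zero : FinRank (0 : H →L[ℂ] H) := LinearMap.HasFiniteRange.zero

theorem FinRank.add {F G : H →L[ℂ] H} (hF : FinRank F) (hG : FinRank G) : FinRank (F + G) :=
  LinearMap.HasFiniteRange.add hF hG

theorem FinRank.neg {F : H →L[ℂ] H} (hF : FinRank F) : FinRank (-F) :=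
  LinearMap.HasFiniteRange.neg hF

theorem FinRank.sub {F G : H →L[ℂ] H} (hF : FinRank F) (hG : FinRank G) : FinRank (F - G) :=
  LinearMap.HasFiniteRange.sub hF hG

theorem FinRank.smul {F : H →L[ℂ] H} (c : ℂ) (hF : FinRank F) : FinRank (c • F) :=
  LinearMap.HasFiniteRange.smul hF c

theorem FinRank.mul_left {F : H →L[ℂ] H} (hF : FinRank F) (T : H →L[ℂ] H) : FinRank (T * F) :=
  LinearMap.HasFiniteRange.comp_left hF (T : H →ₗ[ℂ] H)

theorem FinRank.mul_right {F : H →L[ℂ] H} (hF : FinRank F) (T : H →L[ℂ] H) : FinRank (F * T) :=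
  LinearMap.HasFiniteRange.comp_right hF (T : H →ₗ[ℂ] H)

theorem isFredholm_add_of_finRank {T F : H →L[ℂ] H} (hT : T.IsFredholm)
    (hF : FinRank F) : (T + F).IsFredholm := by
  obtain ⟨v, hv⟩ := hT.exists_isQuasiInverse
  refine ContinuousLinearMap.IsFredholm.of_isQuasiInverse (v := v)
    (hv.congr (Setoid.refl _) ?_)
  rw [LinearMap.FiniteRangeSetoid.equiv_iff_hasFiniteRange]
  simpa using (show (F : H →ₗ[ℂ] H).HasFiniteRange from hF)

theorem isFredholm_mul {S T : H →L[ℂ] H} (hS : S.IsFredholm) (hT : T.IsFredholm) :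
    (S * T).IsFredholm := by
  obtain ⟨u, hu⟩ := hS.exists_isQuasiInverse
  obtain ⟨v, hv⟩ := hT.exists_isQuasiInverse
  exact ContinuousLinearMap.IsFredholm.of_isQuasiInverse (v := v * u) (hv.comp hu)

theorem isFredholm_of_isUnit {T : H →L[ℂ] H} (hT : IsUnit T) : T.IsFredholm := by
  obtain ⟨u, rfl⟩ := hT
  refine ContinuousLinearMap.IsFredholm.of_isQuasiInverse (v := ↑u⁻¹) ⟨?_, ?_⟩
  · have : ((↑u⁻¹ : H →L[ℂ] H) : H →ₗ[ℂ] H) ∘ₗ ((u : H →L[ℂ] H) : H →ₗ[ℂ] H) = .id :=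
      congrArg ContinuousLinearMap.toLinearMap u.inv_mul
    rw [LinearMap.IsLeftQuasiInverse, this]
  · have : ((u : H →L[ℂ] H) : H →ₗ[ℂ] H) ∘ₗ ((↑u⁻¹ : H →L[ℂ] H) : H →ₗ[ℂ] H) = .id :=
      congrArg ContinuousLinearMap.toLinearMap u.mul_inv
    rw [LinearMap.IsRightQuasiInverse, this]

/-- Fredholmness survives finite-rank perturbation in both directions. This is what keeps the
straight homotopies between finite-rank perturbations inside `BFsaStar H`. -/
theorem essSpectrum_add_of_finRank {F : H →L[ℂ] H} (T : H →L[ℂ] H)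
    (hF : FinRank F) : essSpectrum (T + F) = essSpectrum T := by
  ext r
  refine not_congr ⟨fun h => ?_, fun h => ?_⟩
  · have := isFredholm_add_of_finRank (F := -F) h hF.neg
    convert this using 1
    abel
  · convert isFredholm_add_of_finRank h hF using 1
    abel

theorem essSpectrum_conj (u : (H →L[ℂ] H)ˣ) (T : H →L[ℂ] H) :
    essSpectrum ((u : H →L[ℂ] H) * T * (↑u⁻¹ : H →L[ℂ] H)) = essSpectrum T := by
  have key : ∀ (u : (H →L[ℂ] H)ˣ) (T : H →L[ℂ] H) (r : ℝ),
      (T - (r : ℂ) • (1 : H →L[ℂ] H)).IsFredholm →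
      ((u : H →L[ℂ] H) * T * (↑u⁻¹ : H →L[ℂ] H) - (r : ℂ) • (1 : H →L[ℂ] H)).IsFredholm := by
    intro u T r h
    convert isFredholm_mul (isFredholm_mul (isFredholm_of_isUnit u.isUnit) h)
      (isFredholm_of_isUnit u⁻¹.isUnit) using 1
    simp [mul_sub, sub_mul]
  ext r
  refine not_congr ⟨fun h => ?_, key u T r⟩
  have := key u⁻¹ _ r h
  simpa [mul_assoc] using this

theorem essSpectrum_neg (T : H →L[ℂ] H) : essSpectrum (-T) = -essSpectrum T := by
  have key : ∀ (T : H →L[ℂ] H) (r : ℝ), (T - (r : ℂ) • (1 : H →L[ℂ] H)).IsFredholm →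
      (-T - ((-r : ℝ) : ℂ) • (1 : H →L[ℂ] H)).IsFredholm := by
    intro T r h
    convert isFredholm_mul (isFredholm_of_isUnit (isUnit_one.neg)) h using 1
    simp [mul_sub]
  ext r
  rw [Set.mem_neg]
  refine not_congr ⟨fun h => ?_, fun h => ?_⟩
  · simpa using key _ r h
  · simpa using key _ (-r) h

theorem essentiallyNegative_iff_neg (T : H →L[ℂ] H) :
    EssentiallyNegative T ↔ EssentiallyPositive (-T) := by
  rw [EssentiallyNegative, EssentiallyPositive, essSpectrum_neg, ← Set.neg_subset_neg, Set.neg_Iio,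
    neg_zero]

theorem isFredholm_sub_of_notMem_spectrum {T : H →L[ℂ] H} {r : ℝ} (hr : r ∉ spectrum ℝ T) :
    (T - (r : ℂ) • (1 : H →L[ℂ] H)).IsFredholm := by
  rw [spectrum.notMem_iff, IsUnit.sub_iff] at hr
  convert isFredholm_of_isUnit hr using 2
  ext x; simp [Algebra.algebraMap_eq_smul_one]

theorem essSpectrum_subset_spectrum (T : H →L[ℂ] H) : essSpectrum T ⊆ spectrum ℝ T := by
  intro r hr
  by_contra h
  exact hr (isFredholm_sub_of_notMem_spectrum h)

theorem isFredholm_aeval_prod {T : H →L[ℂ] H} (D : Finset ℝ)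
    (hF : ∀ r ∈ D, (T - (r : ℂ) • (1 : H →L[ℂ] H)).IsFredholm) :
    (Polynomial.aeval T (∏ r ∈ D, (Polynomial.X - Polynomial.C r))).IsFredholm := by
  induction D using Finset.induction_on with
  | empty => simpa using isFredholm_of_isUnit (H := H) isUnit_one
  | insert r D hr ih =>
    rw [Finset.prod_insert hr, map_mul]
    refine isFredholm_mul ?_ (ih fun s hs => hF s (Finset.mem_insert_of_mem hs))
    convert hF r (Finset.mem_insert_self r D) using 1
    ext x; simp [Algebra.algebraMap_eq_smul_one]

variable [CompleteSpace H]

theorem eventually_notMem_spectrum_of_isFredholm_sub {T : H →L[ℂ] H} (hT : IsSelfAdjoint T) {r : ℝ}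
    (hF : (T - (r : ℂ) • (1 : H →L[ℂ] H)).IsFredholm) : ∀ᶠ x in 𝓝[≠] r, x ∉ spectrum ℝ T := by
  have hre : (T - (r : ℂ) • (1 : H →L[ℂ] H)) = T - algebraMap ℝ _ r := by
    ext x; simp [Algebra.algebraMap_eq_smul_one]
  rw [hre] at hF
  have h := eventually_notMem_spectrum (hT.sub (.algebraMap _ (.all r))) hF
  have ht : Filter.Tendsto (fun x => x - r) (𝓝[≠] r) (𝓝[≠] 0) := by
    refine tendsto_nhdsWithin_of_tendsto_nhds_of_eventually_within _ ?_ ?_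
    · have : Filter.Tendsto (fun x => x - r) (𝓝 r) (𝓝 (r - r)) :=
        (continuous_id.sub continuous_const).tendsto r
      rw [sub_self] at this
      exact this.mono_left nhdsWithin_le_nhds
    · filter_upwards [self_mem_nhdsWithin] with x hx
      exact sub_ne_zero.2 hx
  filter_upwards [ht.eventually h] with x hx hxs
  apply hx
  rw [spectrum.mem_iff] at hxs ⊢
  convert hxs using 2
  simp

/-- An infinite intersection would accumulate in the compact set `K`, but at a point where `T - r`
is Fredholm the spectrum has no accumulation. -/
theorem finite_inter_spectrum {T : H →L[ℂ] H} (hT : IsSelfAdjoint T) {K : Set ℝ} (hK : IsCompact K)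
    (hF : ∀ r ∈ K, (T - (r : ℂ) • (1 : H →L[ℂ] H)).IsFredholm) : (K ∩ spectrum ℝ T).Finite := by
  by_contra hinf
  obtain ⟨x, hxK, hx⟩ := Set.Infinite.exists_accPt_of_subset_isCompact hinf hK
    Set.inter_subset_left
  rw [accPt_iff_frequently_nhdsNE] at hx
  exact hx ((eventually_notMem_spectrum_of_isFredholm_sub hT (hF x hxK)).mono
    fun y hy h => hy h.2)

/-- A continuous function supported in a compact set without points of the essential spectrum
gives an operator of finite rank. -/
theorem finRank_cfc {T : H →L[ℂ] H} (hT : IsSelfAdjoint T) {K : Set ℝ} (hK : IsCompact K)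
    (hF : ∀ r ∈ K, (T - (r : ℂ) • (1 : H →L[ℂ] H)).IsFredholm) {g : ℝ → ℝ}
    (hg : ∀ x ∈ spectrum ℝ T, g x ≠ 0 → x ∈ K) :
    FinRank (cfc g T) := by
  -- Where `g` is not continuous on the spectrum, the functional calculus takes the default value
  -- `0`, which has finite rank.
  by_cases hgc : ContinuousOn g (spectrum ℝ T)
  swap
  · rw [cfc_apply_of_not_continuousOn T hgc]
    exact FinRank.zero
  set D := (finite_inter_spectrum hT hK hF).toFinset with hD
  have hDF := isFredholm_aeval_prod (T := T) D (fun r hr => hF r (by simp [hD] at hr; exact hr.1))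
  -- The polynomial vanishes on the finitely many spectral points where `g` can be nonzero, so the
  -- range of `g(T)` lies in the kernel of a Fredholm operator.
  have hz : Polynomial.aeval T (∏ r ∈ D, (Polynomial.X - Polynomial.C r)) * cfc g T = 0 := by
    rw [← cfc_polynomial _ T hT, ← cfc_mul _ _ T (by fun_prop) hgc, ← cfc_zero ℝ T]
    refine cfc_congr fun x hx => ?_
    by_cases h0 : g x = 0
    · simp [h0]
    · have : x ∈ D := by simpa [hD] using ⟨hg x hx h0, hx⟩
      simp only [Pi.zero_apply, Polynomial.eval_prod]
      rw [Finset.prod_eq_zero this (by simp), zero_mul]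
  have := hDF.finite_ker
  have : FiniteDimensional ℂ (cfc g T).range := by
    refine Submodule.finiteDimensional_of_le (S₂ := (Polynomial.aeval T (∏ r ∈ D,
      (Polynomial.X - Polynomial.C r))).ker) ?_
    rintro _ ⟨y, rfl⟩
    exact congrArg (fun A : H →L[ℂ] H => A y) hz
  exact Submodule.FG.of_finite

/-- The characteristic function of `A` is continuous on the spectrum if each boundary point of `A`
in the spectrum is an isolated point of the spectrum. -/
theorem continuousOn_indicator_of_isolated {s A : Set ℝ}
    (h : ∀ x ∈ frontier A, x ∈ s → ∀ᶠ y in 𝓝[≠] x, y ∉ s) :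
    ContinuousOn (Set.indicator A (1 : ℝ → ℝ)) s := by
  intro x hx
  have key : ∀ᶠ y in 𝓝[s] x, Set.indicator A (1 : ℝ → ℝ) y = Set.indicator A (1 : ℝ → ℝ) x := by
    by_cases hf : x ∈ frontier A
    · have h1 := eventually_nhdsWithin_iff.1 (h x hf hx)
      filter_upwards [h1.filter_mono nhdsWithin_le_nhds, self_mem_nhdsWithin] with y hy hys
      rcases eq_or_ne y x with rfl | hy0
      · rfl
      · exact absurd hys (hy hy0)
    · have h1 : ∀ᶠ y in 𝓝 x, (y ∈ A ↔ x ∈ A) := by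
        by_cases hxA : x ∈ A
        · have : x ∈ interior A := by
            by_contra hi
            exact hf ⟨subset_closure hxA, hi⟩
          filter_upwards [mem_interior_iff_mem_nhds.1 this] with y hy using iff_of_true hy hxA
        · have : x ∉ closure A := fun hc => hf ⟨hc, fun hi => hxA (interior_subset hi)⟩
          filter_upwards [isClosed_closure.isOpen_compl.mem_nhds this] with y hy
          exact iff_of_false (fun hyA => hy (subset_closure hyA)) hxA
      filter_upwards [h1.filter_mono nhdsWithin_le_nhds] with y hy
      by_cases hxA : x ∈ A
      · rw [Set.indicator_of_mem hxA, Set.indicator_of_mem (hy.2 hxA)]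
        rfl
      · rw [Set.indicator_of_notMem hxA, Set.indicator_of_notMem (fun h => hxA (hy.1 h))]
  exact tendsto_const_nhds.congr' (key.mono fun y hy => hy.symm)

end Fredholm

/-! ### Essential positivity and negativity through the quadratic form. -/

section Form

variable {H : Type*} [NormedAddCommGroup H] [InnerProductSpace ℂ H]

theorem exists_ne_zero_of_finRank {N : H →L[ℂ] H} (hN : FinRank N) {V : Submodule ℂ H}
    (hV : ¬ FiniteDimensional ℂ V) : ∃ x ∈ V, x ≠ 0 ∧ N x = 0 := by
  by_contra! h
  apply hV
  have : FiniteDimensional ℂ N.range := Module.Finite.of_fg hN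
  refine FiniteDimensional.of_injective ((N : H →ₗ[ℂ] H).rangeRestrict ∘ₗ V.subtype) ?_
  rw [injective_iff_map_eq_zero]
  intro a ha
  by_contra ha0
  exact h a a.2 (by simpa using ha0) (congrArg Subtype.val ha)

theorem re_inner_le_of_le {A B : H →L[ℂ] H} (h : A ≤ B) (x : H) :
    (inner ℂ (A x) x).re ≤ (inner ℂ (B x) x).re := by
  have := (ContinuousLinearMap.le_def A B).1 h
  have h2 := this.re_inner_nonneg_left x
  simpa [inner_sub_left] using h2

variable [CompleteSpace H]

theorem re_inner_cfc_mono {T : H →L[ℂ] H} {f g : ℝ → ℝ} (hf : ContinuousOn f (spectrum ℝ T))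
    (hg : ContinuousOn g (spectrum ℝ T)) (h : ∀ x ∈ spectrum ℝ T, f x ≤ g x) (x : H) :
    (inner ℂ (cfc f T x) x).re ≤ (inner ℂ (cfc g T x) x).re :=
  re_inner_le_of_le (cfc_mono h) x

theorem continuousOn_indicator_Iic {T : H →L[ℂ] H} (hT : IsSelfAdjoint T) (hF : T.IsFredholm) :
    ContinuousOn (Set.indicator (Set.Iic 0) (1 : ℝ → ℝ)) (spectrum ℝ T) := by
  refine continuousOn_indicator_of_isolated fun x hx _ => ?_
  rw [frontier_Iic] at hx
  obtain rfl : x = 0 := hx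
  exact eventually_notMem_spectrum hT hF

theorem continuousOn_indicator_Iio {T : H →L[ℂ] H} (hT : IsSelfAdjoint T) (hF : T.IsFredholm) :
    ContinuousOn (Set.indicator (Set.Iio 0) (1 : ℝ → ℝ)) (spectrum ℝ T) := by
  refine continuousOn_indicator_of_isolated fun x hx _ => ?_
  rw [frontier_Iio] at hx
  obtain rfl : x = 0 := hx
  exact eventually_notMem_spectrum hT hF

theorem exists_gap {T : H →L[ℂ] H} (hT : IsSelfAdjoint T) (hF : T.IsFredholm) :
    ∃ c > 0, ∀ x ∈ spectrum ℝ T, x ≠ 0 → c ≤ |x| := by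
  have h := eventually_nhdsWithin_iff.1 (eventually_notMem_spectrum hT hF)
  obtain ⟨c, hc, h⟩ := Metric.eventually_nhds_iff.1 h
  refine ⟨c, hc, fun x hx h0 => ?_⟩
  by_contra hlt
  exact h (by simpa using hlt) h0 hx

/-- A self-adjoint operator whose form is nonpositive on an infinite-dimensional subspace is not
essentially positive. -/
theorem not_essentiallyPositive_of_form {T : H →L[ℂ] H} (hT : IsSelfAdjoint T)
    {V : Submodule ℂ H} (hV : ¬ FiniteDimensional ℂ V)
    (h : ∀ x ∈ V, (inner ℂ (T x) x).re ≤ 0) : ¬ EssentiallyPositive T := by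
  intro hpos
  have hFr : ∀ r : ℝ, r ≤ 0 → (T - (r : ℂ) • (1 : H →L[ℂ] H)).IsFredholm := by
    intro r hr
    by_contra hn
    exact absurd (hpos hn) (not_lt.2 hr)
  have hF : T.IsFredholm := by simpa using hFr 0 le_rfl
  set g : ℝ → ℝ := Set.indicator (Set.Iic 0) 1 with hg
  have hgc := continuousOn_indicator_Iic hT hF
  have hN : FinRank (cfc g T) := by
    -- The half-line is cut down to a compact set by intersecting it with the spectrum.
    refine finRank_cfc hT (K := Set.Iic 0 ∩ spectrum ℝ T) ?_ (fun r hr => hFr r hr.1) ?_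
    · exact (ContinuousFunctionalCalculus.isCompact_spectrum T).inter_left isClosed_Iic
    · intro x hx hx0
      exact ⟨Set.mem_of_indicator_ne_zero hx0, hx⟩
  obtain ⟨x, hxV, hx0, hNx⟩ := exists_ne_zero_of_finRank hN hV
  obtain ⟨c, hc, hgap⟩ := exists_gap hT hF
  -- Above zero the spectrum starts at the gap `c`, so `c (1 - g) ≤ x (1 - g)` on it. At a vector
  -- killed by `g(T)` this reads `c ‖x‖² ≤ ⟨T x, x⟩`, against the sign of the form on `V`.
  have hle := re_inner_cfc_mono (T := T) (f := fun x => c * (1 - g x))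
    (g := fun x => x * (1 - g x)) (by fun_prop) (by fun_prop) (fun y hy => ?_) x
  · have e1 : cfc (fun x => c * (1 - g x)) T = (c : ℂ) • (1 - cfc g T) := by
      rw [cfc_const_mul c _ T (by fun_prop), cfc_sub (fun _ => 1) g T, cfc_const_one ℝ T]
      ext; simp
    have e2 : cfc (fun x => x * (1 - g x)) T = T * (1 - cfc g T) := by
      rw [cfc_mul (fun x => x) _ T (by fun_prop) (by fun_prop), cfc_sub (fun _ => 1) g T,
        cfc_const_one ℝ T, cfc_id' ℝ T]
    rw [e1, e2] at hle
    have hx := h x hxV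
    have hn : 0 < ‖x‖ := norm_pos_iff.2 hx0
    simp [hNx] at hle
    have : 0 < c * (inner ℂ x x).re := mul_pos hc (by
      have := inner_self_eq_norm_sq (𝕜 := ℂ) x
      simp only [RCLike.re_eq_complex_re] at this
      rw [this]; positivity)
    simp at this
    linarith
  · by_cases hy0 : y ≤ 0
    · simp [hg, hy0]
    · push Not at hy0
      have := hgap y hy hy0.ne'
      rw [abs_of_pos hy0] at this
      simpa [hg, hy0] using this

theorem not_essentiallyNegative_of_form {T : H →L[ℂ] H} (hT : IsSelfAdjoint T)
    {V : Submodule ℂ H} (hV : ¬ FiniteDimensional ℂ V)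
    (h : ∀ x ∈ V, 0 ≤ (inner ℂ (T x) x).re) : ¬ EssentiallyNegative T := by
  rw [essentiallyNegative_iff_neg]
  exact not_essentiallyPositive_of_form hT.neg hV fun x hx => by simpa using h x hx

/-- Membership in `BFsaStar`. -/
def IsBF (T : H →L[ℂ] H) : Prop :=
  IsSelfAdjoint T ∧ T.IsFredholm ∧ ¬ EssentiallyPositive T ∧ ¬ EssentiallyNegative T

theorem IsBF.add {T F : H →L[ℂ] H} (hT : IsBF T) (hF : IsSelfAdjoint F) (hFr : FinRank F) :
    IsBF (T + F) := by
  refine ⟨hT.1.add hF, isFredholm_add_of_finRank hT.2.1 hFr, ?_, ?_⟩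
  · rw [EssentiallyPositive, essSpectrum_add_of_finRank _ hFr]
    exact hT.2.2.1
  · rw [EssentiallyNegative, essSpectrum_add_of_finRank _ hFr]
    exact hT.2.2.2

theorem IsBF.neg {T : H →L[ℂ] H} (hT : IsBF T) : IsBF (-T) := by
  refine ⟨hT.1.neg, ?_, ?_, ?_⟩
  · convert isFredholm_mul (isFredholm_of_isUnit (isUnit_one (M := H →L[ℂ] H)).neg) hT.2.1 using 1
    simp
  · rw [← essentiallyNegative_iff_neg]
    exact hT.2.2.2
  · rw [essentiallyNegative_iff_neg, neg_neg]
    exact hT.2.2.1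

theorem IsBF.conj {T : H →L[ℂ] H} (hT : IsBF T) (u : unitary (H →L[ℂ] H)) :
    IsBF ((u : H →L[ℂ] H) * T * star (u : H →L[ℂ] H)) := by
  have he := essSpectrum_conj (Unitary.toUnits u) T
  have e : (↑(Unitary.toUnits u)⁻¹ : H →L[ℂ] H) = star (u : H →L[ℂ] H) := rfl
  rw [e, Unitary.val_toUnits_apply] at he
  refine ⟨hT.1.conjugate (u : H →L[ℂ] H), ?_, ?_, ?_⟩
  · refine isFredholm_mul (isFredholm_mul (isFredholm_of_isUnit ?_) hT.2.1)
      (isFredholm_of_isUnit ?_)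
    · exact (Unitary.toUnits u).isUnit
    · exact (Unitary.toUnits u)⁻¹.isUnit
  · rw [EssentiallyPositive, he]
    exact hT.2.2.1
  · rw [EssentiallyNegative, he]
    exact hT.2.2.2

theorem IsBF.of_form {T : H →L[ℂ] H} (hT : IsSelfAdjoint T) (hF : T.IsFredholm)
    {V W : Submodule ℂ H} (hV : ¬ FiniteDimensional ℂ V) (hW : ¬ FiniteDimensional ℂ W)
    (hVn : ∀ x ∈ V, (inner ℂ (T x) x).re ≤ 0) (hWp : ∀ x ∈ W, 0 ≤ (inner ℂ (T x) x).re) :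
    IsBF T :=
  ⟨hT, hF, not_essentiallyPositive_of_form hT hV hVn, not_essentiallyNegative_of_form hT hW hWp⟩

/-- The negative spectral subspace of an invertible operator that is not essentially positive has
infinite dimension. -/
theorem infinite_range_indicator_Iio {S : H →L[ℂ] H} (hS : IsSelfAdjoint S) (hu : IsUnit S)
    (hn : ¬ EssentiallyPositive S) :
    ¬ FiniteDimensional ℂ (cfc (Set.indicator (Set.Iio 0) (1 : ℝ → ℝ)) S).range := by
  intro hfin
  apply hn
  set g : ℝ → ℝ := Set.indicator (Set.Iio 0) 1 with hg
  have hgc := continuousOn_indicator_Iio hS (isFredholm_of_isUnit hu)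
  have hN : FinRank (cfc g S) := Submodule.FG.of_finite
  -- If the negative spectral projection had finite rank, `S` would be a finite-rank perturbation of
  -- `|S|`, whose spectrum lies in `(0, ∞)` because `S` is invertible.
  have e : cfc (fun x : ℝ => |x|) S = S + ((-2 : ℂ) • (S * cfc g S)) := by
    have e1 : cfc (fun x => x + (-2) * (x * g x)) S = S + ((-2 : ℂ) • (S * cfc g S)) := by
      rw [cfc_add S _ _ (by fun_prop) (by fun_prop), cfc_const_mul _ _ S (by fun_prop),
        cfc_mul _ _ S (by fun_prop) (by fun_prop), cfc_id' ℝ S]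
      congr 1
      ext x
      simp
      norm_cast
    rw [← e1]
    refine cfc_congr fun x hx => ?_
    by_cases h0 : x < 0
    · simp [hg, h0, abs_of_neg h0]; ring
    · push Not at h0
      simp [hg, h0, abs_of_nonneg h0]
  have := essSpectrum_add_of_finRank S ((hN.mul_left S).smul (-2))
  rw [EssentiallyPositive, ← this, ← e]
  refine (essSpectrum_subset_spectrum _).trans ?_
  rw [cfc_map_spectrum (fun x : ℝ => |x|) S]
  rintro _ ⟨x, hx, rfl⟩
  have : x ≠ 0 := by
    rintro rfl
    exact spectrum.zero_notMem ℝ hu hx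
  exact (abs_pos.2 this : (0 : ℝ) < |x|)

end Form

/-! ### Unitaries joined to the identity that match orthonormal sequences. -/

section UnitaryPaths

variable {H : Type*} [NormedAddCommGroup H] [InnerProductSpace ℂ H]

theorem exists_unit_orthogonal {A : Submodule ℂ H} (hA : ¬ FiniteDimensional ℂ A) (s : Set H)
    (hs : s.Finite) : ∃ v ∈ A, ‖v‖ = 1 ∧ ∀ u ∈ s, inner ℂ u v = 0 := by
  have : FiniteDimensional ℂ (Submodule.span ℂ s) := .span_of_finite ℂ hs
  obtain ⟨v, hvA, hv0, hv⟩ := exists_ne_zero_of_finRank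
    (N := (Submodule.span ℂ s).starProjection) (by
      have : FiniteDimensional ℂ (Submodule.span ℂ s).starProjection.range := by
        rw [Submodule.range_starProjection]; infer_instance
      exact Submodule.FG.of_finite) hA
  rw [Submodule.starProjection_apply_eq_zero_iff] at hv
  refine ⟨((‖v‖⁻¹ : ℝ) : ℂ) • v, A.smul_mem _ hvA, ?_, fun u hu => ?_⟩
  · rw [norm_smul]
    simp [norm_ne_zero_iff.2 hv0]
  · rw [inner_smul_right, hv u (Submodule.subset_span hu), mul_zero]

/-- Two infinite-dimensional subspaces contain mutually orthogonal orthonormal sequences. -/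
theorem exists_orthonormal_pair {A B : Submodule ℂ H} (hA : ¬ FiniteDimensional ℂ A)
    (hB : ¬ FiniteDimensional ℂ B) : ∃ z w : ℕ → H, Orthonormal ℂ z ∧ Orthonormal ℂ w ∧
      (∀ n, z n ∈ A) ∧ (∀ n, w n ∈ B) ∧ ∀ m n, inner ℂ (z m) (w n) = 0 := by
  -- Both sequences are chosen together, as one sequence of pairs with each new pair orthogonal to
  -- all entries of the earlier ones; this is what makes `z` and `w` mutually orthogonal.
  obtain ⟨f, hP, hr⟩ := exists_seq_of_forall_finset_exists
    (fun p : H × H => p.1 ∈ A ∧ p.2 ∈ B ∧ ‖p.1‖ = 1 ∧ ‖p.2‖ = 1 ∧ inner ℂ p.1 p.2 = 0)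
    (fun p q : H × H => inner ℂ p.1 q.1 = 0 ∧ inner ℂ p.1 q.2 = 0 ∧
      inner ℂ p.2 q.1 = 0 ∧ inner ℂ p.2 q.2 = 0) (by
    intro s _
    obtain ⟨v, hvA, hv1, hv⟩ := exists_unit_orthogonal hA
      (Prod.fst '' (s : Set (H × H)) ∪ Prod.snd '' (s : Set (H × H)))
      ((s.finite_toSet.image _).union (s.finite_toSet.image _))
    obtain ⟨w, hwB, hw1, hw⟩ := exists_unit_orthogonal hB
      (Prod.fst '' (s : Set (H × H)) ∪ Prod.snd '' (s : Set (H × H)) ∪ {v})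
      (((s.finite_toSet.image _).union (s.finite_toSet.image _)).union (Set.finite_singleton v))
    refine ⟨(v, w), ⟨hvA, hwB, hv1, hw1, hw v (by simp)⟩, fun p hp => ⟨?_, ?_, ?_, ?_⟩⟩
    · exact hv _ (Or.inl ⟨p, hp, rfl⟩)
    · exact hw _ (Or.inl (Or.inl ⟨p, hp, rfl⟩))
    · exact hv _ (Or.inr ⟨p, hp, rfl⟩)
    · exact hw _ (Or.inl (Or.inr ⟨p, hp, rfl⟩)))
  refine ⟨fun n => (f n).1, fun n => (f n).2, ⟨fun n => (hP n).2.2.1, ?_⟩,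
    ⟨fun n => (hP n).2.2.2.1, ?_⟩, fun n => (hP n).1, fun n => (hP n).2.1, ?_⟩
  · intro m n hmn
    rcases lt_or_gt_of_ne hmn with h | h
    · exact (hr m n h).1
    · exact inner_eq_zero_symm.1 (hr n m h).1
  · intro m n hmn
    rcases lt_or_gt_of_ne hmn with h | h
    · exact (hr m n h).2.2.2
    · exact inner_eq_zero_symm.1 (hr n m h).2.2.2
  · intro m n
    rcases lt_trichotomy m n with h | rfl | h
    · exact (hr m n h).2.1
    · exact (hP m).2.2.2.2
    · exact inner_eq_zero_symm.1 (hr n m h).2.2.1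

variable [CompleteSpace H]

theorem one_add_smul_mem_unitary {P : H →L[ℂ] H} (hP : IsStarProjection P) {a : ℂ}
    (ha : ‖a‖ = 1) : 1 + (a - 1) • P ∈ unitary (H →L[ℂ] H) := by
  have h1 : a * star a = 1 := by
    rw [Complex.star_def, Complex.mul_conj, Complex.normSq_eq_norm_sq, ha]; simp
  have hPP : P * P = P := hP.isIdempotentElem
  have hPs : star P = P := hP.isSelfAdjoint
  have key : ∀ b c : ℂ, b * c = 1 →
      (1 + (b - 1) • P) * (1 + (c - 1) • P) = (1 : H →L[ℂ] H) := by
    intro b c hbc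
    have : (b - 1) * (c - 1) = 1 - b - c + 1 := by linear_combination hbc
    rw [mul_add, add_mul, add_mul, smul_mul_smul_comm, hPP, this]
    simp only [mul_one, one_mul]
    module
  have hs : star (1 + (a - 1) • P) = 1 + (star a - 1) • P := by
    simp [hPs]
  rw [Unitary.mem_iff, hs]
  exact ⟨key _ _ (by rw [mul_comm, h1]), key _ _ h1⟩

/-- A reflection is joined to the identity by a path of unitary operators. -/
theorem joined_one_sub_two_smul {P : H →L[ℂ] H} (hP : IsStarProjection P) :
    ∃ u : unitary (H →L[ℂ] H), (u : H →L[ℂ] H) = 1 - (2 : ℂ) • P ∧ Joined 1 u := by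
  let U : I → unitary (H →L[ℂ] H) := fun s =>
    ⟨1 + (Complex.exp ((Real.pi * s : ℝ) * Complex.I) - 1) • P,
      one_add_smul_mem_unitary hP (Complex.norm_exp_ofReal_mul_I _)⟩
  have hU : Continuous U := by
    refine Continuous.subtype_mk ?_ _
    fun_prop
  refine ⟨U 1, ?_, ⟨⟨⟨U, hU⟩, ?_, rfl⟩⟩⟩
  · simp only [U, Set.Icc.coe_one, mul_one, Complex.exp_pi_mul_I]
    module
  · ext1
    simp [U]

/-- The reflection `1 - 2 P_K`, with `K` the closed span of the differences `x n - y n`, negates `x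
n - y n` and fixes `x n + y n`, since mutual orthogonality puts the latter in the complement of `K`.
So it sends `x n` to `y n`. -/
theorem joined_swap {x y : ℕ → H} (hx : Orthonormal ℂ x) (hy : Orthonormal ℂ y)
    (hxy : ∀ m n, inner ℂ (x m) (y n) = 0) :
    ∃ u : unitary (H →L[ℂ] H), (∀ n, (u : H →L[ℂ] H) (x n) = y n) ∧ Joined 1 u := by
  set K := (Submodule.span ℂ (Set.range fun n => x n - y n)).topologicalClosure with hK
  have hKc : CompleteSpace K :=
    (Submodule.isClosed_topologicalClosure _).completeSpace_coe
  obtain ⟨u, hu, hj⟩ := joined_one_sub_two_smul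
    (isStarProjection_starProjection (U := K))
  refine ⟨u, fun n => ?_, hj⟩
  have h1 : K.starProjection (x n - y n) = x n - y n :=
    Submodule.starProjection_eq_self_iff.2
      (Submodule.le_topologicalClosure _ (Submodule.subset_span ⟨n, rfl⟩))
  have h2 : K.starProjection (x n + y n) = 0 := by
    rw [Submodule.starProjection_apply_eq_zero_iff]
    have : K ≤ (ℂ ∙ (x n + y n))ᗮ := by
      refine Submodule.topologicalClosure_minimal _ ?_ (Submodule.isClosed_orthogonal _)
      rw [Submodule.span_le]
      rintro _ ⟨m, rfl⟩
      rw [SetLike.mem_coe, Submodule.mem_orthogonal_singleton_iff_inner_left]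
      simp only [inner_sub_left, inner_add_right, hxy,
        inner_eq_zero_symm.1 (hxy n m)]
      rcases eq_or_ne m n with rfl | h
      · simp [hx.1, hy.1]
      · simp [hx.2 h, hy.2 h]
    intro z hz
    exact Submodule.mem_orthogonal_singleton_iff_inner_left.1 (this hz)
  rw [map_sub] at h1
  rw [map_add] at h2
  rw [hu]
  simp only [sub_apply, one_apply_eq_self, smul_apply]
  have h3 : (2 : ℂ) • K.starProjection (x n) = x n - y n := by
    rw [← h1, two_smul, eq_neg_of_add_eq_zero_right h2]; abel
  rw [h3]; abel

theorem joined_mul {u v : unitary (H →L[ℂ] H)} (hu : Joined 1 u) (hv : Joined 1 v) :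
    Joined 1 (u * v) := by
  simpa using hu.mul hv

/-- Orthonormal sequences of infinite codimension are conjugate by a unitary operator in the path
component of the identity. -/
theorem joined_orthonormal {x y : ℕ → H} (hx : Orthonormal ℂ x) (hy : Orthonormal ℂ y)
    (hxc : ¬ FiniteDimensional ℂ (Submodule.span ℂ (Set.range x))ᗮ)
    (hyc : ¬ FiniteDimensional ℂ (Submodule.span ℂ (Set.range y))ᗮ) :
    ∃ u : unitary (H →L[ℂ] H), (∀ n, (u : H →L[ℂ] H) (x n) = y n) ∧ Joined 1 u := by
  -- The sequences `x` and `y` need not be orthogonal to each other, so one passes through `x → z →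
  -- w → y`, where consecutive sequences are.
  obtain ⟨z, w, hz, hw, hzA, hwB, hzw⟩ := exists_orthonormal_pair hxc hyc
  obtain ⟨u, hu, hju⟩ := joined_swap hx hz
    fun m n => hzA n _ (Submodule.subset_span ⟨m, rfl⟩)
  obtain ⟨v, hv, hjv⟩ := joined_swap hz hw hzw
  obtain ⟨t, ht, hjt⟩ := joined_swap hw hy
    fun m n => inner_eq_zero_symm.1 (hwB m _ (Submodule.subset_span ⟨n, rfl⟩))
  refine ⟨t * v * u, fun n => ?_, joined_mul (joined_mul hjt hjv) hju⟩
  simp [hu, hv, ht]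

/-- An infinite-dimensional closed subspace of a separable Hilbert space has an orthonormal basis
indexed by `ℕ` starting with a given unit vector. -/
theorem exists_orthonormal_seq [TopologicalSpace.SeparableSpace H] {M : Submodule ℂ H}
    (hM : IsClosed (M : Set H)) (hinf : ¬ FiniteDimensional ℂ M) {e : H} (heM : e ∈ M)
    (he : ‖e‖ = 1) : ∃ x : ℕ → H, Orthonormal ℂ x ∧ x 0 = e ∧
      (Submodule.span ℂ (Set.range x)).topologicalClosure = M := by
  have : CompleteSpace M := hM.completeSpace_coe
  have he' : Orthonormal ℂ ((↑) : ({⟨e, heM⟩} : Set M) → M) := by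
    refine ⟨?_, ?_⟩
    · rintro ⟨_, rfl⟩; exact he
    · rintro ⟨_, rfl⟩ ⟨_, rfl⟩ h; exact absurd rfl h
  obtain ⟨w, b, hw, hb⟩ := he'.exists_hilbertBasis_extension
  have hbo : Orthonormal ℂ ((↑) : w → M) := hb ▸ b.orthonormal
  have hspan : (Submodule.span ℂ w).topologicalClosure = ⊤ := by
    have := b.dense_span
    rwa [hb, Subtype.range_coe] at this
  have hcount : Countable w := by
    have : SecondCountableTopology H := UniformSpace.secondCountable_of_separable H
    -- Orthonormal vectors are at distance `√2`, so balls of radius `1/2` around them are disjoint,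
    -- and separability bounds their number.
    refine Pairwise.countable_of_isOpen_disjoint (s := fun v : w => Metric.ball (v : M) (1 / 2))
      ?_ (fun v => Metric.isOpen_ball) (fun v => ⟨v, Metric.mem_ball_self (by norm_num)⟩)
    intro v v' hvv
    refine Metric.ball_disjoint_ball ?_
    have h2 : ‖(v : M) - v'‖ * ‖(v : M) - v'‖ = 2 := by
      rw [← sq, norm_sub_sq (𝕜 := ℂ), hbo.2 hvv, hbo.1, hbo.1]
      norm_num
    rw [dist_eq_norm]
    nlinarith [norm_nonneg ((v : M) - v')]
  have hinfw : Infinite w := by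
    by_contra hfin
    rw [not_infinite_iff_finite] at hfin
    have : FiniteDimensional ℂ (Submodule.span ℂ w) := .span_of_finite ℂ (Set.toFinite w)
    rw [IsClosed.submodule_topologicalClosure_eq (Submodule.closed_of_finiteDimensional _)]
      at hspan
    rw [hspan] at this
    exact hinf (Module.Finite.equiv (Submodule.topEquiv (R := ℂ) (M := M)))
  obtain ⟨φ⟩ := nonempty_equiv_of_countable (α := ℕ) (β := w)
  let e₀ : w := ⟨⟨e, heM⟩, hw rfl⟩
  -- A transposition moves the prescribed vector `e` to index `0`.
  let ψ : ℕ ≃ w := (Equiv.swap 0 (φ.symm e₀)).trans φ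
  have hψ : ψ 0 = e₀ := by simp [ψ]
  refine ⟨fun n => (ψ n : M), ?_, ?_, ?_⟩
  · exact (hbo.comp ψ ψ.injective).comp_linearIsometry M.subtypeₗᵢ
  · simp [hψ, e₀]
  · have hr : Set.range (fun n => ((ψ n : M) : H)) = M.subtype '' w := by
      ext v
      constructor
      · rintro ⟨n, rfl⟩
        exact ⟨ψ n, (ψ n).2, rfl⟩
      · rintro ⟨v, hv, rfl⟩
        exact ⟨ψ.symm ⟨v, hv⟩, by simp⟩
    rw [hr, ← Submodule.map_span]
    apply le_antisymm
    · exact Submodule.topologicalClosure_minimal _ (Submodule.map_subtype_le _ _) hM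
    · intro v hv
      have h1 : (⟨v, hv⟩ : M) ∈ closure (Submodule.span ℂ w : Set M) := by
        rw [← Submodule.topologicalClosure_coe, hspan]; trivial
      exact map_mem_closure (f := ((↑) : M → H)) continuous_subtype_val h1
        fun u hu => ⟨u, hu, rfl⟩

end UnitaryPaths

/-! ### Formal consequences of concatenation and homotopy invariance. -/

section PathInvariants

variable {X : Type*} [TopologicalSpace X] {Y : Set X}

/-- A path between points of `Y`, as an element of `Ω(X, Y)`. -/
def Omega.ofPath {x y : X} (p : Path x y) (hx : x ∈ Y) (hy : y ∈ Y) : Omega X Y :=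
  ⟨p.toContinuousMap, by simpa using hx, by simpa using hy⟩

theorem Omega.ext_apply {f g : Omega X Y} (h : ∀ t, f.1 t = g.1 t) : f = g :=
  Subtype.ext (ContinuousMap.ext h)

variable {μ : Omega X Y → ℤ}

theorem SatisfiesConcatenation.ofPath_trans (hμ : SatisfiesConcatenation μ) {x y z : X}
    (p : Path x y) (q : Path y z) (hx : x ∈ Y) (hy : y ∈ Y) (hz : z ∈ Y) :
    μ (.ofPath (p.trans q) hx hz) = μ (.ofPath p hx hy) + μ (.ofPath q hy hz) := by
  rw [← hμ (.ofPath p hx hy) (.ofPath q hy hz) (by simp [Omega.ofPath])]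
  rfl

theorem SatisfiesHomotopy.ofPath_eq (hμ : SatisfiesHomotopy μ) {x y : X} {p q : Path x y}
    (h : p.Homotopic q) (hx : x ∈ Y) (hy : y ∈ Y) :
    μ (.ofPath p hx hy) = μ (.ofPath q hx hy) := by
  obtain ⟨F⟩ := h
  refine hμ _ _ ⟨F.toContinuousMap, fun t => ?_, fun t => ?_, fun s => ⟨?_, ?_⟩⟩
  · exact F.apply_zero t
  · exact F.apply_one t
  · simpa using hx
  · simpa using hy

/-- Free homotopies may move endpoints within `Y`, so a path lying in `Y` contracts to the constant
path at its start. That constant path equals its own concatenation with itself, hence its value `m`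
satisfies `m = m + m`. -/
theorem mu_eq_zero_of_forall_mem (hc : SatisfiesConcatenation μ) (hh : SatisfiesHomotopy μ)
    (f : Omega X Y) (hf : ∀ t, f.1 t ∈ Y) : μ f = 0 := by
  set x := f.1 0 with hx
  have h0 := hc.ofPath_trans (Path.refl x) (Path.refl x) (hf 0) (hf 0) (hf 0)
  rw [Path.refl_trans_refl] at h0
  have h1 : μ f = μ (.ofPath (Path.refl x) (hf 0) (hf 0)) := by
    refine hh _ _ ⟨⟨fun p => f.1 (σ p.1 * p.2), by fun_prop⟩, ?_, ?_, ?_⟩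
    · intro t; simp
    · intro t; simp [Omega.ofPath, hx]
    · intro s; exact ⟨hf _, hf _⟩
  omega

end PathInvariants

/-! ### Straight segments along finite-rank perturbations. -/

section Segments

variable {H : Type*} [NormedAddCommGroup H] [InnerProductSpace ℂ H]

/-- The convex combination `(1 - t) S + t T`. -/
def lineOp (S T : H →L[ℂ] H) (t : ℝ) : H →L[ℂ] H := S + (t : ℂ) • (T - S)

@[simp] theorem lineOp_zero (S T : H →L[ℂ] H) : lineOp S T 0 = S := by simp [lineOp]

@[simp] theorem lineOp_one (S T : H →L[ℂ] H) : lineOp S T 1 = T := by simp [lineOp]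

variable [CompleteSpace H]

theorem isSelfAdjoint_ofReal_smul {A : H →L[ℂ] H} (hA : IsSelfAdjoint A) (t : ℝ) :
    IsSelfAdjoint ((t : ℂ) • A) :=
  IsSelfAdjoint.smul (Complex.conj_ofReal t) hA

theorem IsBF.line {S T : H →L[ℂ] H} (hS : IsBF S) (hT : IsSelfAdjoint T)
    (h : FinRank (T - S)) (t : ℝ) : IsBF (lineOp S T t) :=
  hS.add (isSelfAdjoint_ofReal_smul (hT.sub hS.1) t) (h.smul _)

/-- The straight path between operators that differ by an operator of finite rank. -/
def seg (S T : BFsaStar H) (h : FinRank (T.1 - S.1)) : Path S T where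
  toFun t := ⟨lineOp S.1 T.1 t, IsBF.line S.2 T.2.1 h t⟩
  continuous_toFun := by
    refine Continuous.subtype_mk ?_ _
    unfold lineOp
    fun_prop
  source' := by ext1; simp
  target' := by ext1; simp

theorem seg_apply (S T : BFsaStar H) (h : FinRank (T.1 - S.1)) (t : I) :
    (seg S T h t).1 = lineOp S.1 T.1 t := rfl

/-- Two paths with the same endpoints are homotopic if all their values differ from the starting
point by operators of finite rank. -/
theorem homotopic_of_finRank {S T : BFsaStar H} (p q : Path S T)
    (hp : ∀ t, FinRank ((p t).1 - S.1)) (hq : ∀ t, FinRank ((q t).1 - S.1)) :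
    p.Homotopic q := by
  have hmem : ∀ x : I × I, IsBF (lineOp (p x.2).1 (q x.2).1 x.1) := fun x =>
    IsBF.line (p x.2).2 (q x.2).2.1 (by simpa using (hq x.2).sub (hp x.2)) _
  refine ⟨⟨⟨⟨fun x => ⟨lineOp (p x.2).1 (q x.2).1 x.1, hmem x⟩, ?_⟩, ?_, ?_⟩, ?_⟩⟩
  · refine Continuous.subtype_mk ?_ _
    unfold lineOp
    fun_prop
  · intro t; ext1; simp
  · intro t; ext1; simp
  · rintro t x (rfl | hx)
    · ext1; simp [lineOp]
    · obtain rfl : x = 1 := hx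
      ext1; simp [lineOp]

theorem finRank_seg_sub {S T : BFsaStar H} (h : FinRank (T.1 - S.1)) (t : I) :
    FinRank ((seg S T h t).1 - S.1) := by
  rw [seg_apply, lineOp, add_sub_cancel_left]
  exact h.smul _

theorem seg_trans_homotopic {S T U : BFsaStar H} (h₁ : FinRank (T.1 - S.1))
    (h₂ : FinRank (U.1 - T.1)) (h₃ : FinRank (U.1 - S.1)) :
    ((seg S T h₁).trans (seg T U h₂)).Homotopic (seg S U h₃) := by
  refine homotopic_of_finRank _ _ (fun t => ?_) (finRank_seg_sub h₃)
  rw [Path.trans_apply]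
  split_ifs
  · exact finRank_seg_sub h₁ _
  · simpa using (finRank_seg_sub h₂ ⟨_, _⟩).add h₁

end Segments

/-! ### Invertible operators polarized by a fixed projection. -/

section Polarized

variable {H : Type*} [NormedAddCommGroup H] [InnerProductSpace ℂ H] [CompleteSpace H]

/-- `S` is self-adjoint, commutes with the orthogonal projection `R`, is bounded below by a positive
constant on the range of `R` and bounded above by a negative one on its kernel. -/
structure Polarized (S R : H →L[ℂ] H) : Prop where
  isSelfAdjoint : IsSelfAdjoint S
  isStarProjection : IsStarProjection R
  commute : Commute R S
  form : ∃ c > 0, ∀ x, c * ‖x‖ ^ 2 ≤ (inner ℂ (((2 : ℂ) • R - 1) (S x)) x).re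

namespace Polarized

variable {S S' R : H →L[ℂ] H}

/-- The form bound makes `(2R - 1) S` coercive, hence invertible, and `2R - 1` is an involution. -/
theorem isUnit (h : Polarized S R) : IsUnit S := by
  obtain ⟨c, hc, hf⟩ := h.form
  have h1 : IsUnit (((2 : ℂ) • R - 1) * S) := by
    refine ContinuousLinearMap.isUnit_of_forall_le_norm_inner_map _ (c := ⟨c, hc.le⟩) hc
      fun x => ?_
    refine le_trans ?_ (Complex.re_le_norm _)
    have := hf x
    rw [mul_apply_eq_comp, mul_comm]
    exact this
  have hRR : R * R = R := h.isStarProjection.isIdempotentElem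
  have h2 : ((2 : ℂ) • R - 1) * ((2 : ℂ) • R - 1) = 1 := by
    rw [sub_mul, mul_sub, smul_mul_smul_comm, hRR, one_mul, mul_one]
    module
  have h3 : IsUnit ((2 : ℂ) • R - 1) := ⟨⟨_, _, h2, h2⟩, rfl⟩
  have h4 := h3.mul h1
  rwa [← mul_assoc, h2, one_mul] at h4

/-- The form of `S` is nonnegative on the range of `R` and nonpositive on the range of `1 - R`; when
both are infinite-dimensional, neither essential sign is possible. -/
theorem isBF (h : Polarized S R) (hR : ¬ FiniteDimensional ℂ R.range)
    (hR' : ¬ FiniteDimensional ℂ (1 - R).range) : IsBF S := by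
  obtain ⟨c, hc, hf⟩ := h.form
  have hRR : R * R = R := h.isStarProjection.isIdempotentElem
  refine IsBF.of_form h.isSelfAdjoint (isFredholm_of_isUnit h.isUnit) hR' hR ?_ ?_
  · rintro _ ⟨y, rfl⟩
    have h1 : R (S ((1 - R) y)) = 0 := by
      have : R * S * (1 - R) = 0 := by
        rw [h.commute.eq, mul_assoc, mul_sub, hRR]; simp
      exact congrArg (fun A : H →L[ℂ] H => A y) this
    have h2 := hf ((1 - R) y)
    have h4 : ((2 : ℂ) • R - 1) (S ((1 - R) y)) = -S ((1 - R) y) := by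
      rw [sub_apply ((2 : ℂ) • R), smul_apply, h1, smul_zero, zero_sub, one_apply_eq_self]
    rw [h4, inner_neg_left, Complex.neg_re] at h2
    have h3 : 0 ≤ c * ‖(1 - R) y‖ ^ 2 := by positivity
    rw [ContinuousLinearMap.coe_coe]
    linarith
  · rintro _ ⟨y, rfl⟩
    have h1 : R (S (R y)) = S (R y) := by
      have : R * S * R = S * R := by
        rw [h.commute.eq, mul_assoc, hRR]
      exact congrArg (fun A : H →L[ℂ] H => A y) this
    have h2 := hf (R y)
    have h3 : 0 ≤ c * ‖R y‖ ^ 2 := by positivity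
    have h4 : ((2 : ℂ) • R - 1) (S (R y)) = S (R y) := by
      rw [sub_apply, smul_apply, h1, one_apply_eq_self]; module
    rw [h4] at h2
    exact h3.trans h2

theorem conj (h : Polarized S R) (u : unitary (H →L[ℂ] H)) :
    Polarized ((u : H →L[ℂ] H) * S * star (u : H →L[ℂ] H))
      ((u : H →L[ℂ] H) * R * star (u : H →L[ℂ] H)) := by
  obtain ⟨c, hc, hf⟩ := h.form
  have hus : star (u : H →L[ℂ] H) * u = 1 := Unitary.star_mul_self_of_mem u.2
  have hsu : (u : H →L[ℂ] H) * star (u : H →L[ℂ] H) = 1 := Unitary.mul_star_self_of_mem u.2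
  have key : ∀ A B : H →L[ℂ] H, ((u : H →L[ℂ] H) * A * star (u : H →L[ℂ] H)) *
      ((u : H →L[ℂ] H) * B * star (u : H →L[ℂ] H)) = u * (A * B) * star (u : H →L[ℂ] H) := by
    intro A B
    calc _ = (u : H →L[ℂ] H) * A * (star (u : H →L[ℂ] H) * u) * B * star (u : H →L[ℂ] H) := by
          simp only [mul_assoc]
      _ = _ := by rw [hus]; simp only [mul_assoc, mul_one]
  refine ⟨h.isSelfAdjoint.conjugate _, ⟨?_, h.isStarProjection.isSelfAdjoint.conjugate _⟩, ?_, c,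
    hc, fun x => ?_⟩
  · rw [IsIdempotentElem, key, h.isStarProjection.isIdempotentElem.eq]
  · rw [Commute, SemiconjBy, key, key, h.commute.eq]
  · have h1 : (2 : ℂ) • ((u : H →L[ℂ] H) * R * star (u : H →L[ℂ] H)) - 1 =
        u * ((2 : ℂ) • R - 1) * star (u : H →L[ℂ] H) := by
      rw [mul_sub, sub_mul, mul_one, hsu, mul_smul_comm, smul_mul_assoc]
    rw [h1, ← mul_apply_eq_comp, key]
    have h2 := hf (star (u : H →L[ℂ] H) x)
    have h3 : ‖star (u : H →L[ℂ] H) x‖ = ‖x‖ := by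
      have h4 : inner ℂ (star (u : H →L[ℂ] H) x) (star (u : H →L[ℂ] H) x) = inner ℂ x x := by
        rw [ContinuousLinearMap.star_eq_adjoint, ContinuousLinearMap.adjoint_inner_left,
          ← ContinuousLinearMap.star_eq_adjoint, ← mul_apply_eq_comp, hsu]
        simp
      rw [inner_self_eq_norm_sq_to_K, inner_self_eq_norm_sq_to_K] at h4
      have h5 : ‖star (u : H →L[ℂ] H) x‖ ^ 2 = ‖x‖ ^ 2 := by exact_mod_cast h4
      exact (sq_eq_sq₀ (norm_nonneg _) (norm_nonneg _)).1 h5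
    rw [h3] at h2
    refine h2.trans_eq ?_
    rw [ContinuousLinearMap.star_eq_adjoint, ContinuousLinearMap.adjoint_inner_right]
    rfl

/-- For fixed `R` the form bound is linear in `S`, so polarized operators form a convex set. This
supplies straight homotopies through invertible operators. -/
theorem line (h : Polarized S R) (h' : Polarized S' R) {t : ℝ} (ht₀ : 0 ≤ t) (ht₁ : t ≤ 1) :
    Polarized (lineOp S S' t) R := by
  obtain ⟨c, hc, hf⟩ := h.form
  obtain ⟨c', hc', hf'⟩ := h'.form
  refine ⟨h.isSelfAdjoint.add (isSelfAdjoint_ofReal_smul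
    (h'.isSelfAdjoint.sub h.isSelfAdjoint) t), h.isStarProjection,
    h.commute.add_right ((h'.commute.sub_right h.commute).smul_right _), min c c',
    lt_min hc hc', fun x => ?_⟩
  have e : ((2 : ℂ) • R - 1) (lineOp S S' t x) =
      ((1 - t : ℝ) : ℂ) • ((2 : ℂ) • R - 1) (S x) + (t : ℂ) • ((2 : ℂ) • R - 1) (S' x) := by
    simp only [lineOp, add_apply, smul_apply, sub_apply, map_add, map_smul, map_sub,
      one_apply_eq_self]
    push_cast
    module
  rw [e, inner_add_left, inner_smul_left, inner_smul_left, Complex.conj_ofReal,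
    Complex.conj_ofReal, Complex.add_re, Complex.re_ofReal_mul, Complex.re_ofReal_mul]
  have h1 := hf x
  have h2 := hf' x
  have h3 : min c c' * ‖x‖ ^ 2 ≤ c * ‖x‖ ^ 2 := by gcongr; exact min_le_left _ _
  have h4 : min c c' * ‖x‖ ^ 2 ≤ c' * ‖x‖ ^ 2 := by gcongr; exact min_le_right _ _
  nlinarith [mul_le_mul_of_nonneg_left (h3.trans h1) (sub_nonneg.2 ht₁),
    mul_le_mul_of_nonneg_left (h4.trans h2) ht₀]

/-- The defect `e - R e` would again satisfy `S v = v`, but it lies in the kernel of `R`, where the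
form of `S` is negative. -/
theorem apply_eq_self (h : Polarized S R) {e : H} (he : S e = e) : R e = e := by
  obtain ⟨c, hc, hf⟩ := h.form
  have hRR : ∀ y, R (R y) = R y := fun y =>
    congrArg (fun A : H →L[ℂ] H => A y) h.isStarProjection.isIdempotentElem.eq
  have hRS : R (S e) = S (R e) := congrArg (fun A : H →L[ℂ] H => A e) h.commute.eq
  have h1 : S (e - R e) = e - R e := by rw [map_sub, ← hRS, he]
  have h2 := hf (e - R e)
  rw [h1] at h2
  have h3 : ((2 : ℂ) • R - 1) (e - R e) = -(e - R e) := by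
    simp [hRR]
  rw [h3, inner_neg_left, Complex.neg_re] at h2
  have h4 : (inner ℂ (e - R e) (e - R e)).re = ‖e - R e‖ ^ 2 := inner_self_eq_norm_sq (𝕜 := ℂ) _
  rw [h4] at h2
  have h5 : ‖e - R e‖ ^ 2 = 0 := by nlinarith [sq_nonneg ‖e - R e‖]
  exact (sub_eq_zero.1 (norm_eq_zero.1 (pow_eq_zero_iff two_ne_zero |>.1 h5))).symm

end Polarized

/-- Invertible elements of `BFsaStar` are polarized by projections of infinite rank and corank. -/
theorem exists_polarized {S : H →L[ℂ] H} (hS : IsBF S) (hu : IsUnit S) :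
    ∃ R, Polarized S R ∧ ¬ FiniteDimensional ℂ R.range ∧ ¬ FiniteDimensional ℂ (1 - R).range := by
  set g : ℝ → ℝ := Set.indicator (Set.Iio 0) 1 with hg
  have hsa : IsSelfAdjoint S := hS.1
  have hgc := continuousOn_indicator_Iio hS.1 hS.2.1
  have hN := infinite_range_indicator_Iio hS.1 hu hS.2.2.1
  have h0 : ∀ x ∈ spectrum ℝ S, x ≠ 0 := by
    rintro x hx rfl
    exact spectrum.zero_notMem ℝ hu hx
  -- Because `0` is not in the spectrum, the negative projection of `-S` is the positive projection
  -- of `S`; its infinite rank follows from the statement for `-S`.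
  have hneg : cfc g (-S) = 1 - cfc g S := by
    have hgm : Set.EqOn (fun x => g (-x)) (fun x => 1 - g x) (spectrum ℝ S) := by
      intro x hx
      rcases lt_or_gt_of_ne (h0 x hx) with h | h
      · simp [hg, h, h.le]
      · simp [hg, h, h.le]
    have hgc' : ContinuousOn (fun x => g (-x)) (spectrum ℝ S) :=
      ContinuousOn.congr (by fun_prop) hgm
    rw [← cfc_comp_neg g S (by
      rintro _ ⟨x, hx, rfl⟩
      have := continuousOn_indicator_Iio hS.neg.1 hS.neg.2.1
      have h1 := this (-x) (by simpa [← spectrum.neg_eq] using hx)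
      simpa [← spectrum.neg_eq] using h1) hS.1, cfc_congr hgm, cfc_sub (fun _ => 1) g S,
      cfc_const_one ℝ S]
  have hN' := infinite_range_indicator_Iio hS.neg.1 hu.neg hS.neg.2.2.1
  rw [← hg, hneg] at hN'
  obtain ⟨c, hc, hgap⟩ := exists_gap hS.1 hS.2.1
  have hcomm : Commute (cfc g S) S := by
    have := cfc_commute_cfc g id S
    rwa [cfc_id ℝ S] at this
  refine ⟨1 - cfc g S, ⟨hS.1, ?_, ?_, c, hc, fun x => ?_⟩, hN', by rwa [sub_sub_cancel]⟩
  · refine IsStarProjection.one_sub ⟨?_, IsSelfAdjoint.cfc⟩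
    rw [IsIdempotentElem, ← cfc_mul g g S]
    refine cfc_congr fun x _ => ?_
    by_cases h : x < 0 <;> simp [hg, h]
  · exact (Commute.one_left _).sub_left hcomm
  · have hle := re_inner_cfc_mono (T := S) (f := fun _ => c) (g := fun y => (1 - 2 * g y) * y)
      (by fun_prop) (by fun_prop) (fun y hy => ?_) x
    · rw [cfc_mul _ _ S (by fun_prop) (by fun_prop), cfc_sub (fun _ => 1) _ S,
        cfc_const_one ℝ S, cfc_const_mul _ _ S, cfc_id' ℝ S, cfc_const c S] at hle
      have e1 : (inner ℂ (algebraMap ℝ (H →L[ℂ] H) c x) x).re = c * ‖x‖ ^ 2 := by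
        have : algebraMap ℝ (H →L[ℂ] H) c x = (c : ℂ) • x := by
          simp [Algebra.algebraMap_eq_smul_one]
        rw [this, inner_smul_left, Complex.conj_ofReal, Complex.re_ofReal_mul]
        congr 1
        exact inner_self_eq_norm_sq (𝕜 := ℂ) _
      have e2 : (2 : ℂ) • (1 - cfc g S) - 1 = 1 - (2 : ℝ) • cfc g S := by
        ext y
        simp only [sub_apply, smul_apply, one_apply_eq_self]
        have : (2 : ℝ) • cfc g S y = (2 : ℂ) • cfc g S y := by
          rw [two_smul, two_smul]
        rw [this]; module
      rw [e1] at hle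
      rw [e2]
      exact hle
    · have := hgap y hy (h0 y hy)
      rcases lt_or_gt_of_ne (h0 y hy) with h | h
      · rw [abs_of_neg h] at this
        simp [hg, h]; linarith
      · rw [abs_of_pos h] at this
        simpa [hg, h.le] using this

end Polarized

/-! ### A single eigenvalue crossing zero contributes one. -/

section Crossing

variable {H : Type*} [NormedAddCommGroup H] [InnerProductSpace ℂ H]

/-- The operator `c P + (1 - P) S`. -/
def crossing (P S : H →L[ℂ] H) (c : ℝ) : H →L[ℂ] H := (c : ℂ) • P + (1 - P) * S

/-- Since `(1 - P) P = 0`, the value already placed on the range of `P` is forgotten. This allows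
`S` to be replaced by `crossing P S 1` without altering the path. -/
theorem crossing_crossing {P : H →L[ℂ] H} (hP : P * P = P) (S : H →L[ℂ] H) (c d : ℝ) :
    crossing P (crossing P S d) c = crossing P S c := by
  have h1 : (1 - P) * P = 0 := by rw [sub_mul, hP, one_mul, sub_self]
  have h2 : (1 - P) * (1 - P) = 1 - P := by rw [mul_sub, h1, mul_one, sub_zero]
  rw [crossing, crossing, crossing, mul_add, mul_smul_comm, h1, ← mul_assoc, h2, smul_zero,
    zero_add]

theorem commute_crossing {P S : H →L[ℂ] H} (h : Commute P S) (c : ℝ) :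
    Commute P (crossing P S c) :=
  ((Commute.refl P).smul_right _).add_right
    (((Commute.one_right P).sub_right (Commute.refl P)).mul_right h)

theorem crossing_mul {P S : H →L[ℂ] H} (hP : P * P = P) (h : Commute P S) (c : ℝ) :
    crossing P S c * P = (c : ℂ) • P := by
  have h1 : (1 - P) * P = 0 := by rw [sub_mul, hP, one_mul, sub_self]
  rw [crossing, add_mul, smul_mul_assoc, hP, mul_assoc, ← h.eq, ← mul_assoc, h1, zero_mul,
    add_zero]

theorem isUnit_crossing {P S : H →L[ℂ] H} (hP : P * P = P) (h : Commute P S) (hS : IsUnit S)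
    {c : ℝ} (hc : c ≠ 0) : IsUnit (crossing P S c) := by
  obtain ⟨u, rfl⟩ := hS
  have hi : Commute P (↑u⁻¹ : H →L[ℂ] H) := h.units_inv_right
  have hc' : (c : ℂ) ≠ 0 := by exact_mod_cast hc
  have h1 : (1 - P) * P = 0 := by rw [sub_mul, hP, one_mul, sub_self]
  have h1' : P * (1 - P) = 0 := by rw [mul_sub, hP, mul_one, sub_self]
  have h2 : (1 - P) * (1 - P) = 1 - P := by rw [mul_sub, h1, mul_one, sub_zero]
  -- The inverse is the crossing operator built from `S⁻¹` and `c⁻¹`; one product formula serves for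
  -- both sides.
  have key : ∀ (A B : H →L[ℂ] H) (r s : ℂ), Commute P A → A * B = 1 → r * s = 1 →
      (r • P + (1 - P) * A) * (s • P + (1 - P) * B) = 1 := by
    intro A B r s hA hAB hrs
    have hA' : A * (1 - P) = (1 - P) * A := by rw [mul_sub, sub_mul, hA.eq, one_mul, mul_one]
    have e1 : (1 - P) * A * P = 0 := by rw [mul_assoc, ← hA.eq, ← mul_assoc, h1, zero_mul]
    have e2 : (1 - P) * A * ((1 - P) * B) = 1 - P := by
      rw [mul_assoc, ← mul_assoc A, hA', mul_assoc (1 - P) A B, hAB, mul_one, h2]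
    rw [add_mul, mul_add, mul_add, smul_mul_smul_comm, hP, hrs, smul_mul_assoc, ← mul_assoc P,
      h1', zero_mul, smul_zero, mul_smul_comm, e1, smul_zero, e2]
    simp
  exact ⟨⟨_, crossing P ↑u⁻¹ c⁻¹, key _ _ _ _ h u.mul_inv (by push_cast; exact mul_inv_cancel₀ hc'),
    key _ _ _ _ hi u.inv_mul (by push_cast; exact inv_mul_cancel₀ hc')⟩, rfl⟩

theorem FinRank.of_finrank_eq_one {P : H →L[ℂ] H}
    (h : Module.finrank ℂ (LinearMap.range (P : H →ₗ[ℂ] H)) = 1) : FinRank P := by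
  have : FiniteDimensional ℂ (LinearMap.range (P : H →ₗ[ℂ] H)) :=
    FiniteDimensional.of_finrank_eq_succ h
  exact Submodule.FG.of_finite

variable [CompleteSpace H]

theorem IsBF.crossing {P S : H →L[ℂ] H} (hS : IsBF S) (hP : IsStarProjection P)
    (hPr : FinRank P) (h : Commute P S) (c : ℝ) : IsBF (crossing P S c) := by
  have e : SpectralFlow.crossing P S c = S + ((c : ℂ) • P - P * S) := by
    rw [SpectralFlow.crossing, sub_mul, one_mul]; abel
  rw [e]
  refine hS.add ((isSelfAdjoint_ofReal_smul hP.isSelfAdjoint c).sub ?_)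
    ((hPr.smul _).sub (hPr.mul_right S))
  exact (IsSelfAdjoint.commute_iff hP.isSelfAdjoint hS.1).1 h

/-- The path `t ↦ ((1 - t) a + t b) P + (1 - P) S`. -/
def crossingPath {P S : H →L[ℂ] H} (hS : IsBF S) (hu : IsUnit S) (hP : IsStarProjection P)
    (hPr : FinRank P) (h : Commute P S) {a b : ℝ} (ha : a ≠ 0) (hb : b ≠ 0) :
    Omega (BFsaStar H) (GBFsaStar H) :=
  ⟨⟨fun t => ⟨crossing P S ((1 - t) * a + t * b), hS.crossing hP hPr h _⟩, by
      refine Continuous.subtype_mk ?_ _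
      unfold crossing
      fun_prop⟩, by
    refine ⟨isUnit_crossing hP.isIdempotentElem h hu ?_,
      isUnit_crossing hP.isIdempotentElem h hu ?_⟩
    · simpa using ha
    · simpa using hb⟩

theorem mu_crossing_homotopy {μ : Omega (BFsaStar H) (GBFsaStar H) → ℤ}
    (hh : SatisfiesHomotopy μ) {P S : I → H →L[ℂ] H} {a b : I → ℝ} (hPc : Continuous P)
    (hSc : Continuous S) (hac : Continuous a) (hbc : Continuous b) (hS : ∀ s, IsBF (S s))
    (hu : ∀ s, IsUnit (S s)) (hP : ∀ s, IsStarProjection (P s)) (hPr : ∀ s, FinRank (P s))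
    (h : ∀ s, Commute (P s) (S s)) (ha : ∀ s, a s ≠ 0) (hb : ∀ s, b s ≠ 0)
    (f g : Omega (BFsaStar H) (GBFsaStar H))
    (hf : ∀ t, (f.1 t).1 = crossing (P 0) (S 0) ((1 - t) * a 0 + t * b 0))
    (hg : ∀ t, (g.1 t).1 = crossing (P 1) (S 1) ((1 - t) * a 1 + t * b 1)) : μ f = μ g := by
  refine hh _ _ ⟨⟨fun x => ⟨crossing (P x.1) (S x.1) ((1 - x.2) * a x.1 + x.2 * b x.1),
    (hS x.1).crossing (hP x.1) (hPr x.1) (h x.1) _⟩, ?_⟩, fun t => ?_, fun t => ?_, fun s => ⟨?_, ?_⟩⟩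
  · refine Continuous.subtype_mk ?_ _
    unfold crossing
    fun_prop
  · exact Subtype.ext (hf t).symm
  · exact Subtype.ext (hg t).symm
  · exact isUnit_crossing (hP s).isIdempotentElem (h s) (hu s) (by simpa using ha s)
  · exact isUnit_crossing (hP s).isIdempotentElem (h s) (hu s) (by simpa using hb s)

theorem exists_unit_of_finrank_eq_one {P : H →L[ℂ] H} (hP : IsStarProjection P)
    (h : Module.finrank ℂ (LinearMap.range (P : H →ₗ[ℂ] H)) = 1) :
    ∃ e, ‖e‖ = 1 ∧ P e = e ∧ ∀ y, P y = inner ℂ e y • e := by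
  obtain ⟨⟨v, hv⟩, hv0, hspan⟩ := finrank_eq_one_iff'.1 h
  have hPP : ∀ y, P (P y) = P y := fun y =>
    congrArg (fun A : H →L[ℂ] H => A y) hP.isIdempotentElem.eq
  have hv0 : v ≠ 0 := fun h => hv0 (Subtype.ext h)
  have hPv : P v = v := by obtain ⟨y, rfl⟩ := hv; exact hPP y
  set e : H := ((‖v‖⁻¹ : ℝ) : ℂ) • v with he
  have he1 : ‖e‖ = 1 := by
    rw [he, norm_smul]; simp [norm_ne_zero_iff.2 hv0]
  have hPe : P e = e := by rw [he, map_smul, hPv]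
  refine ⟨e, he1, hPe, fun y => ?_⟩
  obtain ⟨c, hc⟩ := hspan ⟨P y, y, rfl⟩
  have hc : c • v = P y := congrArg Subtype.val hc
  have hve : v = (‖v‖ : ℂ) • e := by
    rw [he, smul_smul, ← Complex.ofReal_mul, mul_inv_cancel₀ (norm_ne_zero_iff.2 hv0)]; simp
  have h1 : P y = (c * ‖v‖) • e := by rw [← hc, mul_smul, ← hve]
  have h2 : inner ℂ e (P y) = inner ℂ e y := by
    have := hP.isSelfAdjoint.isSymmetric e y
    simp only [ContinuousLinearMap.coe_coe] at this
    rw [← this, hPe]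
  rw [← h2, h1, inner_smul_right, inner_self_eq_norm_sq_to_K, he1]
  simp

/-- Since `u` maps the range of `R` into that of `R'`, one has `R' u R = u R`. The same argument for
`star u`, followed by taking adjoints, gives `R' u R = R' u`. Hence `u R = R' u`. -/
theorem conj_eq_of_span {R R' : H →L[ℂ] H} (hR : IsStarProjection R) (hR' : IsStarProjection R')
    {x y : ℕ → H} (hx : (Submodule.span ℂ (Set.range x)).topologicalClosure = R.range)
    (hy : (Submodule.span ℂ (Set.range y)).topologicalClosure = R'.range)
    (u : unitary (H →L[ℂ] H)) (hu : ∀ n, (u : H →L[ℂ] H) (x n) = y n) :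
    (u : H →L[ℂ] H) * R * star (u : H →L[ℂ] H) = R' := by
  have hus : star (u : H →L[ℂ] H) * u = 1 := Unitary.star_mul_self_of_mem u.2
  have hsu : (u : H →L[ℂ] H) * star (u : H →L[ℂ] H) = 1 := Unitary.mul_star_self_of_mem u.2
  have key : ∀ (Q Q' U : H →L[ℂ] H) (x y : ℕ → H), Q' * Q' = Q' →
      (Submodule.span ℂ (Set.range x)).topologicalClosure = Q.range →
      (Submodule.span ℂ (Set.range y)).topologicalClosure = Q'.range →
      (∀ n, U (x n) = y n) → Q' * (U * Q) = U * Q := by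
    intro Q Q' U x y hQ' hx hy hU
    have hle : Q.range ≤ Q'.range.comap (U : H →ₗ[ℂ] H) := by
      rw [← hx, ← hy]
      refine Submodule.topologicalClosure_minimal _ ?_
        ((Submodule.isClosed_topologicalClosure _).preimage U.continuous)
      rw [Submodule.span_le]
      rintro _ ⟨n, rfl⟩
      refine Submodule.le_topologicalClosure _ (Submodule.subset_span ⟨n, (hU n).symm⟩)
    ext z
    obtain ⟨w, hw⟩ := hle ⟨z, rfl⟩
    have hw : Q' w = U (Q z) := hw
    change Q' (U (Q z)) = U (Q z)
    rw [← hw]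
    exact congrArg (fun A : H →L[ℂ] H => A w) hQ'
  have h1 := key R R' u x y hR'.isIdempotentElem hx hy hu
  have h2 := key R' R (star (u : H →L[ℂ] H)) y x hR.isIdempotentElem hy hx fun n => by
    rw [← hu, ← mul_apply_eq_comp, hus, one_apply_eq_self]
  have h3 := congrArg star h2
  simp only [star_mul, star_star, hR.isSelfAdjoint.star_eq, hR'.isSelfAdjoint.star_eq] at h3
  rw [← h1, ← mul_assoc, h3, mul_assoc, hsu, mul_one]

theorem isClosed_range_of_isStarProjection {R : H →L[ℂ] H} (hR : IsStarProjection R) :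
    IsClosed (R.range : Set H) := by
  have hRR : ∀ y, R (R y) = R y := fun y =>
    congrArg (fun A : H →L[ℂ] H => A y) hR.isIdempotentElem.eq
  have : (R.range : Set H) = {v | R v = v} := by
    ext v
    refine ⟨?_, fun h => ⟨v, h⟩⟩
    rintro ⟨y, rfl⟩
    exact hRR y
  rw [this]
  exact isClosed_eq R.continuous continuous_id

theorem infinite_span_orthogonal {R : H →L[ℂ] H} (hR : IsStarProjection R) {s : Set H}
    (hs : (Submodule.span ℂ s).topologicalClosure = R.range)
    (hinf : ¬ FiniteDimensional ℂ (1 - R).range) :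
    ¬ FiniteDimensional ℂ (Submodule.span ℂ s)ᗮ := by
  intro h
  apply hinf
  refine Submodule.finiteDimensional_of_le (S₂ := (Submodule.span ℂ s)ᗮ) ?_
  rintro _ ⟨y, rfl⟩ z hz
  obtain ⟨w, rfl⟩ := hs.le (Submodule.le_topologicalClosure _ hz)
  have := hR.isSelfAdjoint.isSymmetric w ((1 - R) y)
  simp only [ContinuousLinearMap.coe_coe] at this ⊢
  rw [this, ← mul_apply_eq_comp, mul_sub, hR.isIdempotentElem.eq]
  simp

theorem isStarProjection_conj {P : H →L[ℂ] H} (hP : IsStarProjection P)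
    (u : unitary (H →L[ℂ] H)) :
    IsStarProjection ((u : H →L[ℂ] H) * P * star (u : H →L[ℂ] H)) := by
  have hus : star (u : H →L[ℂ] H) * u = 1 := Unitary.star_mul_self_of_mem u.2
  refine ⟨?_, hP.isSelfAdjoint.conjugate _⟩
  calc (u : H →L[ℂ] H) * P * star (u : H →L[ℂ] H) * (u * P * star (u : H →L[ℂ] H))
      = u * P * (star (u : H →L[ℂ] H) * u) * P * star (u : H →L[ℂ] H) := by simp only [mul_assoc]
    _ = u * (P * P) * star (u : H →L[ℂ] H) := by rw [hus]; simp only [mul_assoc, mul_one]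
    _ = _ := by rw [hP.isIdempotentElem.eq]

theorem commute_conj {P S : H →L[ℂ] H} (h : Commute P S) (u : unitary (H →L[ℂ] H)) :
    Commute ((u : H →L[ℂ] H) * P * star (u : H →L[ℂ] H))
      ((u : H →L[ℂ] H) * S * star (u : H →L[ℂ] H)) := by
  have hus : star (u : H →L[ℂ] H) * u = 1 := Unitary.star_mul_self_of_mem u.2
  have key : ∀ A B : H →L[ℂ] H, ((u : H →L[ℂ] H) * A * star (u : H →L[ℂ] H)) *
      ((u : H →L[ℂ] H) * B * star (u : H →L[ℂ] H)) = u * (A * B) * star (u : H →L[ℂ] H) := by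
    intro A B
    calc _ = (u : H →L[ℂ] H) * A * (star (u : H →L[ℂ] H) * u) * B * star (u : H →L[ℂ] H) := by
          simp only [mul_assoc]
      _ = _ := by rw [hus]; simp only [mul_assoc, mul_one]
  rw [Commute, SemiconjBy, key, key, h.eq]

/-- `μ` is `1` on each path along which a simple eigenvalue crosses zero upwards. -/
theorem mu_crossing_eq_one [TopologicalSpace.SeparableSpace H]
    {μ : Omega (BFsaStar H) (GBFsaStar H) → ℤ}
    (hh : SatisfiesHomotopy μ) (hn : SatisfiesNormalization μ) {P S : H →L[ℂ] H} (hS : IsBF S)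
    (hu : IsUnit S) (hP : IsStarProjection P)
    (hP1 : Module.finrank ℂ (LinearMap.range (P : H →ₗ[ℂ] H)) = 1) (hPS : Commute P S) {a b : ℝ}
    (ha : a < 0) (hb : 0 < b) (f : Omega (BFsaStar H) (GBFsaStar H))
    (hf : ∀ t, (f.1 t).1 = crossing P S ((1 - t) * a + t * b)) : μ f = 1 := by
  obtain ⟨⟨T, hT⟩, hTu, Q, hQ, hQ1, hQT, f₀, hf₀, hμ⟩ := hn
  replace hT : IsBF T := hT
  replace hTu : IsUnit T := hTu
  replace hQT : Commute Q T := hQT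
  have hPr := FinRank.of_finrank_eq_one hP1
  have hQr := FinRank.of_finrank_eq_one hQ1
  obtain ⟨e, he1, hPe, hPy⟩ := exists_unit_of_finrank_eq_one hP hP1
  obtain ⟨e', he1', hQe, hQy⟩ := exists_unit_of_finrank_eq_one hQ hQ1
  -- Resetting the eigenvalue on the crossing line to `1` leaves both paths unchanged and puts `e`
  -- and `e'` in the ranges of the positive projections, so that orthonormal bases of these ranges
  -- can start with them.
  have hS₁ := hS.crossing hP hPr hPS 1
  have hT₁ := hT.crossing hQ hQr hQT 1
  have hS₁u := isUnit_crossing hP.isIdempotentElem hPS hu one_ne_zero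
  have hT₁u := isUnit_crossing hQ.isIdempotentElem hQT hTu one_ne_zero
  have hS₁c := commute_crossing hPS 1
  have hT₁c := commute_crossing hQT 1
  have hS₁e : crossing P S 1 e = e := by
    have := congrArg (fun A : H →L[ℂ] H => A e) (crossing_mul hP.isIdempotentElem hPS 1)
    simpa [hPe] using this
  have hT₁e : crossing Q T 1 e' = e' := by
    have := congrArg (fun A : H →L[ℂ] H => A e') (crossing_mul hQ.isIdempotentElem hQT 1)
    simpa [hQe] using this
  have hSS : ∀ c, crossing P (crossing P S 1) c = crossing P S c :=
    fun c => crossing_crossing hP.isIdempotentElem S c 1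
  have hTT : ∀ c, crossing Q (crossing Q T 1) c = crossing Q T c :=
    fun c => crossing_crossing hQ.isIdempotentElem T c 1
  generalize crossing P S 1 = S₁ at hS₁ hS₁u hS₁c hS₁e hSS
  generalize crossing Q T 1 = T₁ at hT₁ hT₁u hT₁c hT₁e hTT
  obtain ⟨R, hR, hRi, hRi'⟩ := exists_polarized hS₁ hS₁u
  obtain ⟨R', hR', hRi₂, hRi₂'⟩ := exists_polarized hT₁ hT₁u
  obtain ⟨x, hxo, hx0, hx⟩ := exists_orthonormal_seq
    (isClosed_range_of_isStarProjection hR.isStarProjection) hRi ⟨e, hR.apply_eq_self hS₁e⟩ he1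
  obtain ⟨y, hyo, hy0, hy⟩ := exists_orthonormal_seq
    (isClosed_range_of_isStarProjection hR'.isStarProjection) hRi₂
    ⟨e', hR'.apply_eq_self hT₁e⟩ he1'
  obtain ⟨u, hxy, ⟨γ⟩⟩ := joined_orthonormal hxo hyo
    (infinite_span_orthogonal hR.isStarProjection hx hRi')
    (infinite_span_orthogonal hR'.isStarProjection hy hRi₂')
  -- As the bases start with `e` and `e'`, the unitary matching them also carries `P` to `Q`.
  have hPQ : (u : H →L[ℂ] H) * P * star (u : H →L[ℂ] H) = Q := by
    have hue : (u : H →L[ℂ] H) e = e' := by rw [← hx0, hxy, hy0]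
    ext z
    simp only [mul_apply_eq_comp, hPy, hQy, map_smul, hue]
    rw [ContinuousLinearMap.star_eq_adjoint, ContinuousLinearMap.adjoint_inner_right, hue]
  have hRR := conj_eq_of_span hR.isStarProjection hR'.isStarProjection hx hy u hxy
  set S' := (u : H →L[ℂ] H) * S₁ * star (u : H →L[ℂ] H) with hS'
  have hpol : Polarized S' R' := hRR ▸ hR.conj u
  have hcomm' : Commute Q S' := hPQ ▸ commute_conj hS₁c u
  have hS'BF : IsBF S' := hS₁.conj u
  have hconjU : ∀ v : unitary (H →L[ℂ] H),
      IsUnit ((v : H →L[ℂ] H) * S₁ * star (v : H →L[ℂ] H)) := fun v => (hR.conj v).isUnit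
  -- Conjugation along `γ` keeps the endpoints invertible and ends with the projection `Q` and an
  -- operator polarized by `R'`.
  have step₁ : μ f = μ (crossingPath hS'BF hpol.isUnit hQ hQr hcomm' ha.ne hb.ne') := by
    refine mu_crossing_homotopy hh (a := fun _ => a) (b := fun _ => b)
      (P := fun s => (γ s : H →L[ℂ] H) * P * star (γ s : H →L[ℂ] H))
      (S := fun s => (γ s : H →L[ℂ] H) * S₁ * star (γ s : H →L[ℂ] H))
      (by fun_prop) (by fun_prop) continuous_const continuous_const (fun s => hS₁.conj _)
      (fun s => hconjU _) (fun s => isStarProjection_conj hP _)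
      (fun s => (hPr.mul_left _).mul_right _) (fun s => commute_conj hS₁c _) (fun _ => ha.ne)
      (fun _ => hb.ne') _ _ (fun t => ?_) (fun t => ?_)
    · simp [hf, hSS]
    · simp [hPQ, ← hS', crossingPath]
  have hline : ∀ (p q : ℝ) (s : I), (0 < p ∧ 0 < q) → 0 < (1 - (s : ℝ)) * p + s * q := by
    rintro p q s ⟨hp, hq⟩
    rcases eq_or_lt_of_le s.2.2 with h | h
    · rw [h]; simpa using hq
    · have h0 : 0 ≤ (s : ℝ) := s.2.1
      have := sub_pos.2 h
      positivity
  -- Now `S'` and `T₁` both commute with `Q` and are polarized by `R'`. They are joined by a segment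
  -- while the end values `a`, `b` move to `∓1/2` without changing sign.
  have step₂ : μ (crossingPath hS'BF hpol.isUnit hQ hQr hcomm' ha.ne hb.ne') = μ f₀ := by
    refine mu_crossing_homotopy hh (a := fun s => (1 - s) * a + s * (-(1 / 2)))
      (b := fun s => (1 - s) * b + s * (1 / 2)) (P := fun _ => Q)
      (S := fun s => lineOp S' T₁ s) continuous_const (by unfold lineOp; fun_prop)
      (by fun_prop) (by fun_prop) (fun s => (hpol.line hR' s.2.1 s.2.2).isBF hRi₂ hRi₂')
      (fun s => (hpol.line hR' s.2.1 s.2.2).isUnit) (fun _ => hQ) (fun _ => hQr)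
      (fun s => ?_) (fun s => ?_) (fun s => ?_) _ _ (fun t => ?_) (fun t => ?_)
    · exact hcomm'.add_right ((hT₁c.sub_right hcomm').smul_right _)
    · have := hline (-a) (1 / 2) s ⟨by linarith, by norm_num⟩
      intro h
      linarith
    · exact (hline b (1 / 2) s ⟨hb, by norm_num⟩).ne'
    · simp [crossingPath]
    · have : (t : ℝ) - 1 / 2 = (1 - t) * (-(1 / 2)) + t * (1 / 2) := by ring
      rw [hf₀, this]
      simp only [Set.Icc.coe_one, lineOp_one, hTT, sub_self, zero_mul, one_mul, zero_add]
      rfl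
  rw [step₁, step₂, hμ]

end Crossing

/-! ### Lifting finitely many negative eigenvalues across zero. -/

section SpectralShift

variable {H : Type*} [NormedAddCommGroup H] [InnerProductSpace ℂ H]

theorem finrank_range_add {P Q : H →L[ℂ] H} (hP : P * P = P) (hQ : Q * Q = Q)
    (hPQ : P * Q = 0) (hQP : Q * P = 0) (hPr : FinRank P) (hQr : FinRank Q) :
    Module.finrank ℂ (P + Q).range = Module.finrank ℂ P.range + Module.finrank ℂ Q.range := by
  have : FiniteDimensional ℂ P.range := Module.Finite.of_fg hPr
  have : FiniteDimensional ℂ Q.range := Module.Finite.of_fg hQr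
  have e := fun (A B : H →L[ℂ] H) (h : A = B) (y : H) => congrArg (fun C : H →L[ℂ] H => C y) h
  have hsup : P.range ⊔ Q.range = (P + Q).range := by
    apply le_antisymm
    · refine sup_le ?_ ?_
      · rintro _ ⟨y, rfl⟩
        refine ⟨P y, ?_⟩
        have h1 : P (P y) = P y := e _ _ hP y
        have h2 : Q (P y) = 0 := e _ _ hQP y
        simp [h1, h2]
      · rintro _ ⟨y, rfl⟩
        refine ⟨Q y, ?_⟩
        have h1 : Q (Q y) = Q y := e _ _ hQ y
        have h2 : P (Q y) = 0 := e _ _ hPQ y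
        simp [h1, h2]
    · rintro _ ⟨y, rfl⟩
      exact Submodule.add_mem_sup ⟨y, rfl⟩ ⟨y, rfl⟩
  have hinf : P.range ⊓ Q.range = ⊥ := by
    rw [eq_bot_iff]
    rintro _ ⟨⟨y, rfl⟩, ⟨z, hz⟩⟩
    have hz : Q z = P y := hz
    have h1 : P (P y) = P y := e _ _ hP y
    have h2 : P (Q z) = 0 := e _ _ hPQ z
    rw [hz, h1] at h2
    exact h2
  have := Submodule.finrank_sup_add_finrank_inf_eq P.range Q.range
  rw [hsup, hinf, finrank_bot, add_zero] at this
  exact this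

theorem finrank_range_rankOne {e : H} (he : ‖e‖ = 1) :
    Module.finrank ℂ (InnerProductSpace.rankOne ℂ e e : H →L[ℂ] H).range = 1 := by
  have he0 : e ≠ 0 := by rintro rfl; simp at he
  have : (InnerProductSpace.rankOne ℂ e e : H →L[ℂ] H).range = ℂ ∙ e := by
    ext y
    rw [Submodule.mem_span_singleton]
    constructor
    · rintro ⟨z, rfl⟩
      exact ⟨_, rfl⟩
    · rintro ⟨c, rfl⟩
      refine ⟨c • e, ?_⟩
      simp [he]
  rw [this, finrank_span_singleton he0]

variable [CompleteSpace H]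

/-- `S` preserves the finite-dimensional nonzero range of `N`, where it has a complex eigenvalue;
self-adjointness makes it real. -/
theorem exists_unit_eigenvector {S N : H →L[ℂ] H} (hS : IsSelfAdjoint S) (hN : N * N = N)
    (hNr : FinRank N) (h : Commute N S) (h0 : N ≠ 0) :
    ∃ (e : H) (r : ℝ), ‖e‖ = 1 ∧ N e = e ∧ S e = (r : ℂ) • e := by
  have : FiniteDimensional ℂ N.range := Module.Finite.of_fg hNr
  have hNN : ∀ y, N (N y) = N y := fun y => congrArg (fun A : H →L[ℂ] H => A y) hN
  have hNS : ∀ y, N (S y) = S (N y) := fun y => congrArg (fun A : H →L[ℂ] H => A y) h.eq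
  have : Nontrivial N.range := by
    rw [Submodule.nontrivial_iff_ne_bot]
    intro hb
    apply h0
    ext y
    exact (Submodule.mem_bot ℂ).1 (hb ▸ (⟨y, rfl⟩ : N y ∈ N.range))
  have hmap : ∀ x ∈ N.range, (S : H →ₗ[ℂ] H) x ∈ N.range := by
    rintro _ ⟨y, rfl⟩
    exact ⟨S y, hNS y⟩
  obtain ⟨l, hl⟩ := Module.End.exists_eigenvalue ((S : H →ₗ[ℂ] H).restrict hmap)
  obtain ⟨⟨v, hv⟩, hve⟩ := hl.exists_hasEigenvector
  have hSv : S v = l • v := congrArg Subtype.val hve.apply_eq_smul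
  have hv0 : v ≠ 0 := fun h => hve.2 (Subtype.ext h)
  have hNv : N v = v := by obtain ⟨y, rfl⟩ := hv; exact hNN y
  have hlr : (l.re : ℂ) = l := by
    have h1 := hS.isSymmetric v v
    simp only [ContinuousLinearMap.coe_coe] at h1
    rw [hSv, inner_smul_left, inner_smul_right] at h1
    have h2 : inner ℂ v v ≠ 0 := inner_self_ne_zero.2 hv0
    exact Complex.conj_eq_iff_re.1 (mul_right_cancel₀ h2 h1)
  refine ⟨((‖v‖⁻¹ : ℝ) : ℂ) • v, l.re, ?_, by rw [map_smul, hNv], ?_⟩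
  · rw [norm_smul]; simp [norm_ne_zero_iff.2 hv0]
  · rw [map_smul, hSv, hlr, smul_comm]

theorem commute_rankOne {S : H →L[ℂ] H} (hS : IsSelfAdjoint S) {e : H} {r : ℝ}
    (he : S e = (r : ℂ) • e) :
    InnerProductSpace.rankOne ℂ e e * S = (r : ℂ) • InnerProductSpace.rankOne ℂ e e ∧
      S * InnerProductSpace.rankOne ℂ e e = (r : ℂ) • InnerProductSpace.rankOne ℂ e e := by
  constructor
  · ext y
    have h1 := hS.isSymmetric e y
    simp only [ContinuousLinearMap.coe_coe] at h1
    simp only [mul_apply_eq_comp, InnerProductSpace.rankOne_apply, smul_apply]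
    rw [← h1, he, inner_smul_left, Complex.conj_ofReal, mul_smul]
  · ext y
    simp only [mul_apply_eq_comp, InnerProductSpace.rankOne_apply, smul_apply]
    rw [map_smul, he, smul_comm]

variable {μ : Omega (BFsaStar H) (GBFsaStar H) → ℤ} [TopologicalSpace.SeparableSpace H]

/-- Moving `k` negative eigenvalues of `S` across zero upwards contributes `k`. -/
theorem mu_seg_eq_finrank (hc : SatisfiesConcatenation μ) (hh : SatisfiesHomotopy μ)
    (hn : SatisfiesNormalization μ) {T : BFsaStar H} (hTu : T ∈ GBFsaStar H) {c : ℝ} (k : ℕ) :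
    ∀ {S : BFsaStar H} (hSu : S ∈ GBFsaStar H) {N : H →L[ℂ] H}, IsStarProjection N → FinRank N →
      Commute N S.1 → Module.finrank ℂ N.range = k →
      (∀ v, N v = v → v ≠ 0 → (inner ℂ (S.1 v) v).re < 0 ∧
        -c * ‖v‖ ^ 2 < (inner ℂ (S.1 v) v).re) →
      T.1 = S.1 + (c : ℂ) • N → ∀ h : FinRank (T.1 - S.1),
      μ (.ofPath (seg S T h) hSu hTu) = k := by
  induction k with
  | zero =>
    intro S hSu N hN hNr hNS hk hform hT h
    have hN0 : N = 0 := by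
      have : FiniteDimensional ℂ N.range := Module.Finite.of_fg hNr
      have hb := Submodule.finrank_eq_zero.1 hk
      ext y
      exact (Submodule.mem_bot ℂ).1 (hb ▸ (⟨y, rfl⟩ : N y ∈ N.range))
    rw [Nat.cast_zero]
    refine mu_eq_zero_of_forall_mem hc hh _ fun t => ?_
    have : (seg S T h t).1 = S.1 := by
      rw [seg_apply, lineOp, hT, hN0]; simp
    change IsUnit (seg S T h t).1
    rw [this]
    exact hSu
  | succ k ih =>
    intro S hSu N hN hNr hNS hk hform hT h
    have hNN := hN.isIdempotentElem.eq
    have hN0 : N ≠ 0 := by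
      rintro rfl
      have hr : (0 : H →L[ℂ] H).range = ⊥ := LinearMap.range_zero
      rw [hr, finrank_bot] at hk
      omega
    obtain ⟨e, r, he1, hNe, hSe⟩ := exists_unit_eigenvector S.2.1 hNN hNr hNS hN0
    have he0 : e ≠ 0 := by rintro rfl; simp at he1
    -- At the eigenvector `e` the form condition says `-c < r < 0`: the eigenvalue starts negative
    -- and becomes positive after adding `c`.
    obtain ⟨hr0, hrc⟩ := hform e hNe he0
    have hre : (inner ℂ (S.1 e) e).re = r := by
      rw [hSe, inner_smul_left, inner_self_eq_norm_sq_to_K, he1]; simp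
    rw [hre] at hr0 hrc
    rw [he1] at hrc
    set P : H →L[ℂ] H := InnerProductSpace.rankOne ℂ e e with hPdef
    have hP : IsStarProjection P := InnerProductSpace.isStarProjection_rankOne_self he1
    have hPP := hP.isIdempotentElem.eq
    have hP1 : Module.finrank ℂ P.range = 1 := finrank_range_rankOne he1
    have hPr := FinRank.of_finrank_eq_one hP1
    obtain ⟨hPS, hSP⟩ := commute_rankOne S.2.1 hSe
    rw [← hPdef] at hPS hSP
    have hcomm : Commute P S.1 := hPS.trans hSP.symm
    have hNP : N * P = P := by
      ext y
      simp [hPdef, hNe]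
    have hPN : P * N = P := by
      have := congrArg star hNP
      rwa [star_mul, hP.isSelfAdjoint.star_eq, hN.isSelfAdjoint.star_eq] at this
    have hN'r : FinRank (N - P) := hNr.sub hPr
    have hN' : IsStarProjection (N - P) := by
      refine ⟨?_, hN.isSelfAdjoint.sub hP.isSelfAdjoint⟩
      rw [IsIdempotentElem, sub_mul, mul_sub, mul_sub, hNN, hNP, hPN, hPP]
      abel
    have hPN' : P * (N - P) = 0 := by rw [mul_sub, hPN, hPP, sub_self]
    have hN'P : (N - P) * P = 0 := by rw [sub_mul, hNP, hPP, sub_self]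
    have hk' : Module.finrank ℂ (N - P).range = k := by
      have := finrank_range_add hPP hN'.isIdempotentElem.eq hPN' hN'P hPr hN'r
      rw [add_sub_cancel, hk, hP1] at this
      omega
    -- As `P S = r P`, adding `c P` is exactly a crossing from `r` to `r + c`. The rest of the lift
    -- acts on the range of `N - P` and is left to the induction.
    have hcross : crossing P S.1 (r + c) = S.1 + (c : ℂ) • P := by
      rw [crossing, sub_mul, one_mul, hPS]; push_cast; module
    have hrc' : r + c ≠ 0 := by nlinarith
    let S' : BFsaStar H := ⟨crossing P S.1 (r + c), IsBF.crossing S.2 hP hPr hcomm _⟩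
    have hS'1 : S'.1 = S.1 + (c : ℂ) • P := hcross
    have hS'u : S' ∈ GBFsaStar H := isUnit_crossing hPP hcomm hSu hrc'
    have h₁ : FinRank (S'.1 - S.1) := by
      rw [hS'1, add_sub_cancel_left]; exact hPr.smul _
    have h₂ : FinRank (T.1 - S'.1) := by
      have := h.sub h₁
      rwa [sub_sub_sub_cancel_right] at this
    have e1 : μ (.ofPath (seg S S' h₁) hSu hS'u) = 1 := by
      refine mu_crossing_eq_one hh hn S.2 hSu hP hP1 hcomm hr0 (b := r + c) (by nlinarith) _
        fun t => ?_
      change lineOp S.1 S'.1 t = _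
      rw [lineOp, hS'1, crossing, sub_mul (1 : H →L[ℂ] H) P, one_mul, hPS]
      push_cast
      module
    have e2 : μ (.ofPath (seg S' T h₂) hS'u hTu) = k := by
      refine ih hS'u hN' hN'r ?_ hk' (fun v hv hv0 => ?_) ?_ h₂
      · rw [hS'1]
        refine (hNS.sub_left hcomm).add_right (Commute.smul_right ?_ _)
        exact hN'P.trans hPN'.symm
      · have hPv : P v = 0 := by
          rw [← hv, ← mul_apply_eq_comp, hPN']; rfl
        have hNv : N v = v := by
          have h3 : N v - P v = v := hv
          rwa [hPv, sub_zero] at h3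
        have hSv : S'.1 v = S.1 v := by
          rw [hS'1]; simp [hPv]
        rw [hSv]
        exact hform v hNv hv0
      · rw [hS'1, hT]
        module
    rw [← hh.ofPath_eq (seg_trans_homotopic h₁ h₂ h) hSu hTu, hc.ofPath_trans _ _ hSu hS'u hTu, e1,
      e2]
    push_cast
    ring

end SpectralShift

/-! ### Comparing the two invertible perturbations `addKer` and `pushUp`. -/

section Sides

variable {H : Type*} [NormedAddCommGroup H] [InnerProductSpace ℂ H] [CompleteSpace H]

/-- `ε > 0`, `±ε ∉ spec T`, and `[-ε, ε]` does not meet the essential spectrum of `T`. -/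
structure Admissible (T : H →L[ℂ] H) (ε : ℝ) : Prop where
  pos : 0 < ε
  notMem : ε ∉ spectrum ℝ T
  neg_notMem : -ε ∉ spectrum ℝ T
  isFredholm : ∀ r ∈ Set.Icc (-ε) ε, (T - (r : ℂ) • (1 : H →L[ℂ] H)).IsFredholm

/-- The characteristic function of a set. -/
abbrev chi (A : Set ℝ) : ℝ → ℝ := Set.indicator A 1

theorem continuousOn_chi_singleton {T : H →L[ℂ] H} (hT : IsSelfAdjoint T) (hF : T.IsFredholm) :
    ContinuousOn (chi {0}) (spectrum ℝ T) := by
  refine continuousOn_indicator_of_isolated fun x hx _ => ?_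
  obtain rfl : x = 0 := by simpa using (isClosed_singleton.frontier_subset hx)
  exact eventually_notMem_spectrum hT hF

theorem continuousOn_chi_Ioo {T : H →L[ℂ] H} (hT : IsSelfAdjoint T) {a b : ℝ} (hab : a < b)
    (ha : (T - (a : ℂ) • (1 : H →L[ℂ] H)).IsFredholm)
    (hb : (T - (b : ℂ) • (1 : H →L[ℂ] H)).IsFredholm) :
    ContinuousOn (chi (Set.Ioo a b)) (spectrum ℝ T) := by
  refine continuousOn_indicator_of_isolated fun x hx _ => ?_
  rw [frontier_Ioo hab] at hx
  rcases hx with rfl | hx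
  · exact eventually_notMem_spectrum_of_isFredholm_sub hT ha
  · obtain rfl : x = b := hx
    exact eventually_notMem_spectrum_of_isFredholm_sub hT hb

theorem isStarProjection_cfc_chi {T : H →L[ℂ] H} {A : Set ℝ}
    (hA : ContinuousOn (chi A) (spectrum ℝ T)) : IsStarProjection (cfc (chi A) T) := by
  refine ⟨?_, IsSelfAdjoint.cfc⟩
  rw [IsIdempotentElem, ← cfc_mul _ _ T hA hA]
  refine cfc_congr fun x _ => ?_
  by_cases h : x ∈ A <;> simp [h]

theorem finRank_cfc_chi {T : H →L[ℂ] H} (hT : IsSelfAdjoint T) {A : Set ℝ} {a b : ℝ}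
    (hA : A ⊆ Set.Icc a b)
    (hF : ∀ r ∈ Set.Icc a b, (T - (r : ℂ) • (1 : H →L[ℂ] H)).IsFredholm) :
    FinRank (cfc (chi A) T) :=
  finRank_cfc hT isCompact_Icc hF fun _ _ hx => hA (Set.mem_of_indicator_ne_zero hx)

theorem finRank_cfc_chi_singleton (T : BFsaStar H) : FinRank (cfc (chi {0}) T.1) := by
  refine finRank_cfc_chi T.2.1 (a := 0) (b := 0) (by simp) fun r hr => ?_
  obtain rfl : r = 0 := by simpa using hr
  simpa using T.2.2.1

/-- `T + 1_{0}(T)`, an invertible operator. -/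
def addKer (T : BFsaStar H) : BFsaStar H :=
  ⟨T.1 + cfc (chi {0}) T.1, IsBF.add T.2 IsSelfAdjoint.cfc (finRank_cfc_chi_singleton T)⟩

theorem finRank_addKer_sub (T : BFsaStar H) : FinRank ((addKer T).1 - T.1) := by
  simpa [addKer] using finRank_cfc_chi_singleton T

theorem Admissible.finRank {T : BFsaStar H} {ε : ℝ} (h : Admissible T.1 ε) :
    FinRank (cfc (chi (Set.Ioo (-ε) ε)) T.1) :=
  finRank_cfc_chi T.2.1 Set.Ioo_subset_Icc_self h.isFredholm

/-- `T + 2 ε 1_{(-ε, ε)}(T)`, an invertible operator. -/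
def pushUp (T : BFsaStar H) {ε : ℝ} (h : Admissible T.1 ε) : BFsaStar H :=
  ⟨T.1 + ((2 * ε : ℝ) : ℂ) • cfc (chi (Set.Ioo (-ε) ε)) T.1,
    IsBF.add T.2 (isSelfAdjoint_ofReal_smul IsSelfAdjoint.cfc _) (h.finRank.smul _)⟩

theorem finRank_pushUp_sub (T : BFsaStar H) {ε : ℝ} (h : Admissible T.1 ε) :
    FinRank ((pushUp T h).1 - T.1) := by
  simpa [pushUp] using h.finRank.smul ((2 * ε : ℝ) : ℂ)

theorem cfc_ofReal_smul {T : H →L[ℂ] H} {g : ℝ → ℝ} (hg : ContinuousOn g (spectrum ℝ T)) (c : ℝ) :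
    (c : ℂ) • cfc g T = cfc (fun x => c * g x) T := by
  rw [cfc_const_mul c g T hg]
  ext x
  simp

theorem addKer_eq_cfc (T : BFsaStar H) : (addKer T).1 = cfc (fun x => x + chi {0} x) T.1 := by
  have hT : IsSelfAdjoint T.1 := T.2.1
  have h0 := continuousOn_chi_singleton T.2.1 T.2.2.1
  rw [cfc_add T.1 _ _ (by fun_prop) h0, cfc_id' ℝ T.1]
  rfl

theorem pushUp_eq_cfc (T : BFsaStar H) {ε : ℝ} (h : Admissible T.1 ε) :
    (pushUp T h).1 = cfc (fun x => x + 2 * ε * chi (Set.Ioo (-ε) ε) x) T.1 := by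
  have hT : IsSelfAdjoint T.1 := T.2.1
  have hε := h.pos
  have h1 := continuousOn_chi_Ioo T.2.1 (a := -ε) (b := ε) (by linarith)
    (h.isFredholm _ ⟨le_rfl, by linarith⟩) (h.isFredholm _ ⟨by linarith, le_rfl⟩)
  rw [cfc_add T.1 _ _ (by fun_prop) (by fun_prop), cfc_id' ℝ T.1, ← cfc_ofReal_smul h1]
  rfl

theorem addKer_mem (T : BFsaStar H) : addKer T ∈ GBFsaStar H := by
  have h0 := continuousOn_chi_singleton T.2.1 T.2.2.1
  change IsUnit (addKer T).1
  rw [addKer_eq_cfc, isUnit_cfc_iff _ T.1 (by fun_prop) T.2.1]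
  intro x _
  by_cases hx : x = 0 <;> simp [hx]

theorem Admissible.continuousOn_chi {T : BFsaStar H} {ε : ℝ} (h : Admissible T.1 ε) :
    ContinuousOn (chi (Set.Ioo (-ε) ε)) (spectrum ℝ T.1) := by
  have hε := h.pos
  exact continuousOn_chi_Ioo T.2.1 (by linarith)
    (h.isFredholm _ ⟨le_rfl, by linarith⟩) (h.isFredholm _ ⟨by linarith, le_rfl⟩)

theorem Admissible.continuousOn_chi_neg {T : BFsaStar H} {ε : ℝ} (h : Admissible T.1 ε) :
    ContinuousOn (chi (Set.Ioo (-ε) 0)) (spectrum ℝ T.1) := by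
  have hε := h.pos
  exact continuousOn_chi_Ioo T.2.1 (by linarith)
    (h.isFredholm _ ⟨le_rfl, by linarith⟩) (h.isFredholm _ ⟨by linarith, by linarith⟩)

theorem pushUp_mem (T : BFsaStar H) {ε : ℝ} (h : Admissible T.1 ε) : pushUp T h ∈ GBFsaStar H := by
  have h0 := h.continuousOn_chi
  have hε := h.pos
  change IsUnit (pushUp T h).1
  rw [pushUp_eq_cfc, isUnit_cfc_iff _ T.1 (by fun_prop) T.2.1]
  intro x _
  by_cases hx : x ∈ Set.Ioo (-ε) ε
  · simp only [chi, Set.indicator_of_mem hx, Pi.one_apply]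
    have := hx.1
    linarith
  · simp only [chi, Set.indicator_of_notMem hx]
    rintro h'
    apply hx
    have : x = 0 := by linarith
    subst this
    exact ⟨by linarith, hε⟩

/-- The rank of `1_{(-ε, 0)}(T)`. -/
def negRank (T : H →L[ℂ] H) (ε : ℝ) : ℕ :=
  Module.finrank ℂ (cfc (chi (Set.Ioo (-ε) 0)) T).range

theorem spectralRank_add_negRank (T : BFsaStar H) {ε : ℝ} (h : Admissible T.1 ε) :
    spectralRank T.1 ε + negRank T.1 ε =
      Module.finrank ℂ (cfc (chi (Set.Ioo (-ε) ε)) T.1).range := by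
  have hε := h.pos
  have h1 := h.continuousOn_chi_neg
  have h2 : ContinuousOn (chi (Set.Ico 0 ε)) (spectrum ℝ T.1) :=
    continuousOn_indicator_spectrum T.2.1 T.2.2.1 h.notMem
  have hd : Disjoint (Set.Ico 0 ε) (Set.Ioo (-ε) 0) := by
    rw [Set.disjoint_left]
    rintro x hx hx'
    exact absurd hx.1 (not_le.2 hx'.2)
  have e0 : cfc (chi (Set.Ico 0 ε)) T.1 * cfc (chi (Set.Ioo (-ε) 0)) T.1 = 0 := by
    rw [← cfc_mul _ _ T.1 h2 h1, ← cfc_zero ℝ T.1]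
    refine cfc_congr fun x _ => ?_
    by_cases hx : x ∈ Set.Ico 0 ε
    · have := Set.disjoint_left.1 hd hx
      simp only [chi, Set.indicator_of_notMem this, mul_zero, Pi.zero_apply]
    · simp only [chi, Set.indicator_of_notMem hx, zero_mul, Pi.zero_apply]
  have e1 : cfc (chi (Set.Ico 0 ε)) T.1 + cfc (chi (Set.Ioo (-ε) 0)) T.1 =
      cfc (chi (Set.Ioo (-ε) ε)) T.1 := by
    rw [← cfc_add T.1 _ _ h2 h1]
    refine cfc_congr fun x _ => ?_
    have : Set.Ioo (-ε) ε = Set.Ico 0 ε ∪ Set.Ioo (-ε) 0 := by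
      rw [Set.union_comm, Set.Ioo_union_Ico_eq_Ioo (by linarith) hε.le]
    rw [this]
    simp only [chi, Set.indicator_union_of_disjoint hd]
  rw [← e1, finrank_range_add (isStarProjection_cfc_chi h2).isIdempotentElem.eq
    (isStarProjection_cfc_chi h1).isIdempotentElem.eq e0
    ((cfc_commute_cfc _ _ T.1).eq.trans e0)
    (finRank_cfc_chi T.2.1 (Set.Ico_subset_Icc_self.trans (Set.Icc_subset_Icc (by linarith) le_rfl))
      h.isFredholm)
    (finRank_cfc_chi T.2.1 (Set.Ioo_subset_Icc_self.trans (Set.Icc_subset_Icc le_rfl (by linarith)))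
      h.isFredholm)]
  rfl

variable {μ : Omega (BFsaStar H) (GBFsaStar H) → ℤ} [TopologicalSpace.SeparableSpace H]

/-- Of the eigenvalues in `(-ε, ε)`, only those in `(-ε, 0)` change sign between the two operators:
`addKer` has already made the kernel positive. -/
theorem mu_seg_addKer_pushUp (hc : SatisfiesConcatenation μ) (hh : SatisfiesHomotopy μ)
    (hn : SatisfiesNormalization μ) (T : BFsaStar H) {ε : ℝ} (h : Admissible T.1 ε)
    (hf : FinRank ((pushUp T h).1 - (addKer T).1)) :
    μ (.ofPath (seg (addKer T) (pushUp T h) hf) (addKer_mem T) (pushUp_mem T h)) =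
      negRank T.1 ε := by
  have hε := h.pos
  have hT : IsSelfAdjoint T.1 := T.2.1
  have h0 := continuousOn_chi_singleton T.2.1 T.2.2.1
  have h1 := h.continuousOn_chi_neg
  have h2 := h.continuousOn_chi
  set N := cfc (chi (Set.Ioo (-ε) 0)) T.1 with hN
  have hNr : FinRank N := finRank_cfc_chi T.2.1
    (Set.Ioo_subset_Icc_self.trans (Set.Icc_subset_Icc le_rfl (by linarith))) h.isFredholm
  have hNp : IsStarProjection N := isStarProjection_cfc_chi h1
  -- The intermediate operator lifts only the eigenvalues in `(-ε, 0)`. The first leg then carries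
  -- all the crossings, and the second moves positive eigenvalues only and stays invertible.
  let V : BFsaStar H := ⟨(addKer T).1 + ((2 * ε : ℝ) : ℂ) • N,
    IsBF.add (addKer T).2 (isSelfAdjoint_ofReal_smul hNp.isSelfAdjoint _) (hNr.smul _)⟩
  have hV : V.1 = (addKer T).1 + ((2 * ε : ℝ) : ℂ) • N := rfl
  have hVcfc : V.1 = cfc (fun x => x + chi {0} x + 2 * ε * chi (Set.Ioo (-ε) 0) x) T.1 := by
    rw [hV, addKer_eq_cfc, cfc_ofReal_smul h1, ← cfc_add T.1 _ _ (by fun_prop) (by fun_prop)]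
  have hline : ∀ t : ℝ, 0 ≤ t → t ≤ 1 → IsUnit (lineOp V.1 (pushUp T h).1 t) := by
    intro t ht0 ht1
    rw [lineOp, pushUp_eq_cfc, hVcfc, ← cfc_sub _ _ T.1 (by fun_prop) (by fun_prop),
      cfc_ofReal_smul (by fun_prop), ← cfc_add T.1 _ _ (by fun_prop) (by fun_prop),
      isUnit_cfc_iff _ T.1 (by fun_prop)]
    intro x _
    rcases eq_or_ne x 0 with rfl | hx
    · have m1 : (0 : ℝ) ∈ Set.Ioo (-ε) ε := ⟨by linarith, hε⟩
      have m2 : (0 : ℝ) ∉ Set.Ioo (-ε) 0 := fun h => lt_irrefl _ h.2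
      simp only [chi, Set.indicator_of_mem m1, Set.indicator_of_notMem m2,
        Set.indicator_of_mem (Set.mem_singleton (0 : ℝ)), Pi.one_apply]
      nlinarith [mul_nonneg ht0 hε.le, mul_pos hε hε]
    · have m0 : x ∉ ({0} : Set ℝ) := hx
      by_cases m1 : x ∈ Set.Ioo (-ε) ε
      · by_cases m2 : x ∈ Set.Ioo (-ε) 0
        · simp only [chi, Set.indicator_of_mem m1, Set.indicator_of_mem m2,
            Set.indicator_of_notMem m0, Pi.one_apply]
          have := m1.1
          ring_nf
          linarith
        · have hx0 : 0 < x := by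
            rcases lt_or_gt_of_ne hx with h' | h'
            · exact absurd ⟨m1.1, h'⟩ m2
            · exact h'
          simp only [chi, Set.indicator_of_mem m1, Set.indicator_of_notMem m2,
            Set.indicator_of_notMem m0, Pi.one_apply]
          nlinarith [mul_nonneg ht0 hε.le]
      · have m2 : x ∉ Set.Ioo (-ε) 0 := fun h' => m1 ⟨h'.1, by linarith [h'.2]⟩
        simp only [chi, Set.indicator_of_notMem m1, Set.indicator_of_notMem m2,
          Set.indicator_of_notMem m0]
        simpa using hx
  have hVu : V ∈ GBFsaStar H := by
    have := hline 0 le_rfl zero_le_one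
    rwa [lineOp_zero] at this
  have f₁ : FinRank (V.1 - (addKer T).1) := by
    rw [hV, add_sub_cancel_left]; exact hNr.smul _
  have f₂ : FinRank ((pushUp T h).1 - V.1) := by
    have := hf.sub f₁
    rwa [sub_sub_sub_cancel_right] at this
  have e₂ : μ (.ofPath (seg V (pushUp T h) f₂) hVu (pushUp_mem T h)) = 0 :=
    mu_eq_zero_of_forall_mem hc hh _ fun t => hline t t.2.1 t.2.2
  have e₁ : μ (.ofPath (seg (addKer T) V f₁) (addKer_mem T) hVu) = negRank T.1 ε := by
    -- The spectral gap gives `⟨W v, v⟩ ≤ -c ‖v‖²` for `W = addKer T` on the range of `N`, hence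
    -- strict negativity. The lower bound `-ε ‖v‖²` lies strictly above the required `-2ε ‖v‖²`.
    obtain ⟨c, hc0, hgap⟩ := exists_gap T.2.1 T.2.2.1
    have hWN : (addKer T).1 * N = cfc (fun x => (x + chi {0} x) * chi (Set.Ioo (-ε) 0) x) T.1 := by
      rw [addKer_eq_cfc, ← cfc_mul _ _ T.1 (by fun_prop) h1]
    refine mu_seg_eq_finrank hc hh hn hVu (c := 2 * ε) (negRank T.1 ε) (addKer_mem T) hNp hNr ?_
      rfl (fun v hv hv0 => ?_) hV f₁
    · rw [addKer_eq_cfc]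
      exact cfc_commute_cfc _ _ _
    · have hn0 : 0 < ‖v‖ ^ 2 := by
        have := norm_pos_iff.2 hv0
        positivity
      have hvv : (inner ℂ v v).re = ‖v‖ ^ 2 := inner_self_eq_norm_sq (𝕜 := ℂ) v
      have hWv : ((addKer T).1 * N) v = (addKer T).1 v := by
        rw [mul_apply_eq_comp, hv]
      have hform : ∀ d : ℝ, (inner ℂ (cfc (fun x => d * chi (Set.Ioo (-ε) 0) x) T.1 v) v).re =
          d * ‖v‖ ^ 2 := by
        intro d
        rw [← cfc_ofReal_smul h1, ← hN, smul_apply, hv, inner_smul_left, Complex.conj_ofReal,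
          Complex.re_ofReal_mul, hvv]
      have hup := re_inner_cfc_mono (T := T.1)
        (f := fun x => (x + chi {0} x) * chi (Set.Ioo (-ε) 0) x)
        (g := fun x => (-c) * chi (Set.Ioo (-ε) 0) x) (by fun_prop) (by fun_prop)
        (fun x hx => ?_) v
      have hlo := re_inner_cfc_mono (T := T.1)
        (f := fun x => (-ε) * chi (Set.Ioo (-ε) 0) x)
        (g := fun x => (x + chi {0} x) * chi (Set.Ioo (-ε) 0) x) (by fun_prop) (by fun_prop)
        (fun x hx => ?_) v
      · rw [hform, ← hWN, hWv] at hup hlo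
        constructor <;> nlinarith
      · by_cases m : x ∈ Set.Ioo (-ε) 0
        · have m0 : x ∉ ({0} : Set ℝ) := m.2.ne
          simp only [chi, Set.indicator_of_mem m, Set.indicator_of_notMem m0, Pi.one_apply]
          linarith [m.1]
        · simp only [chi, Set.indicator_of_notMem m, mul_zero, le_refl]
      · by_cases m : x ∈ Set.Ioo (-ε) 0
        · have m0 : x ∉ ({0} : Set ℝ) := m.2.ne
          have := hgap x hx m.2.ne
          rw [abs_of_neg m.2] at this
          simp only [chi, Set.indicator_of_mem m, Set.indicator_of_notMem m0, Pi.one_apply]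
          linarith
        · simp only [chi, Set.indicator_of_notMem m, mul_zero, le_refl]
  rw [← hh.ofPath_eq (seg_trans_homotopic f₁ f₂ hf) (addKer_mem T) (pushUp_mem T h),
    hc.ofPath_trans _ _ (addKer_mem T) hVu (pushUp_mem T h), e₁, e₂, add_zero]

/-- The endpoint `T` of `p` need not be invertible, so `μ` cannot be split there. The segment to
`pushUp` is instead deformed to pass through the invertible `addKer T`, and the path is split at
that point. -/
theorem mu_trans_pushUp (hc : SatisfiesConcatenation μ) (hh : SatisfiesHomotopy μ)
    (hn : SatisfiesNormalization μ) {S T : BFsaStar H} (hS : S ∈ GBFsaStar H) (p : Path S T)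
    {ε : ℝ} (h : Admissible T.1 ε) :
    μ (.ofPath (p.trans (seg T (pushUp T h) (finRank_pushUp_sub T h))) hS (pushUp_mem T h)) =
      μ (.ofPath (p.trans (seg T (addKer T) (finRank_addKer_sub T))) hS (addKer_mem T)) +
        negRank T.1 ε := by
  have hf : FinRank ((pushUp T h).1 - (addKer T).1) := by
    have := (finRank_pushUp_sub T h).sub (finRank_addKer_sub T)
    rwa [sub_sub_sub_cancel_right] at this
  have hom : (p.trans (seg T (pushUp T h) (finRank_pushUp_sub T h))).Homotopic
      ((p.trans (seg T (addKer T) (finRank_addKer_sub T))).trans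
        (seg (addKer T) (pushUp T h) hf)) :=
    ((Path.Homotopic.refl p).hcomp (seg_trans_homotopic _ hf _).symm).trans
      (Path.Homotopic.trans_assoc _ _ _).symm
  rw [hh.ofPath_eq hom, hc.ofPath_trans _ _ hS (addKer_mem T) (pushUp_mem T h),
    mu_seg_addKer_pushUp hc hh hn T h hf]

end Sides

/-! ### Constancy of ranks, existence of subdivisions, and the telescoping sum. -/

section Main

variable {H : Type*} [NormedAddCommGroup H] [InnerProductSpace ℂ H]

/-- A nonzero vector in the range of `P` killed by `Q` would be moved by its full norm under `P -
Q`. So `Q` is injective on the range of `P`. -/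
theorem finrank_range_le_of_norm_sub_lt {P Q : H →L[ℂ] H} (hP : P * P = P) (hQ : FinRank Q)
    (h : ‖P - Q‖ < 1) : Module.finrank ℂ P.range ≤ Module.finrank ℂ Q.range := by
  have : FiniteDimensional ℂ Q.range := Module.Finite.of_fg hQ
  refine LinearMap.finrank_le_finrank_of_injective
    (f := (Q : H →ₗ[ℂ] H).rangeRestrict ∘ₗ P.range.subtype) ?_
  rw [injective_iff_map_eq_zero]
  rintro ⟨_, y, rfl⟩ hy
  have hQy : Q (P y) = 0 := congrArg Subtype.val hy
  have hPy : P (P y) = P y := congrArg (fun A : H →L[ℂ] H => A y) hP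
  have h1 : ‖P y‖ ≤ ‖P - Q‖ * ‖P y‖ := by
    have := (P - Q).le_opNorm (P y)
    rwa [sub_apply, hQy, hPy, sub_zero] at this
  have h2 : P y = 0 := by
    by_contra h0
    have := norm_pos_iff.2 h0
    nlinarith
  exact Subtype.ext h2

theorem finrank_range_eq_of_continuous {E : I → H →L[ℂ] H} (hE : Continuous E)
    (hP : ∀ s, E s * E s = E s) (hr : ∀ s, FinRank (E s)) (s t : I) :
    Module.finrank ℂ (E s).range = Module.finrank ℂ (E t).range := by
  have hl : IsLocallyConstant fun s => Module.finrank ℂ (E s).range := by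
    rw [IsLocallyConstant.iff_eventually_eq]
    intro s
    have := Metric.tendsto_nhds.1 (hE.tendsto s) 1 one_pos
    filter_upwards [this] with t ht
    rw [dist_eq_norm] at ht
    refine le_antisymm (finrank_range_le_of_norm_sub_lt (hP t) (hr s) ht)
      (finrank_range_le_of_norm_sub_lt (hP s) (hr t) ?_)
    rwa [norm_sub_rev]
  exact hl.apply_eq_of_preconnectedSpace s t

variable [CompleteSpace H]

/-- The union is the projection of a closed subset of `I` times a ball. It provides a common compact
domain for the continuity of the functional calculus in the operator. -/
theorem isCompact_iUnion_spectrum {g : I → H →L[ℂ] H} (hg : Continuous g) :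
    IsCompact (⋃ s, spectrum ℝ (g s)) := by
  obtain ⟨M, hM⟩ := (isCompact_range (hg.norm.mul (continuous_const (y := ‖(1 : H →L[ℂ] H)‖))))
    |>.bddAbove
  have e : (⋃ s, spectrum ℝ (g s)) = Prod.snd '' ((Set.univ ×ˢ Metric.closedBall (0 : ℝ) M) ∩
      {p : I × ℝ | IsUnit (algebraMap ℝ (H →L[ℂ] H) p.2 - g p.1)}ᶜ) := by
    ext x
    simp only [Set.mem_iUnion, Set.mem_image, Prod.exists, exists_eq_right]
    refine exists_congr fun s => ⟨fun hx => ⟨⟨trivial, ?_⟩, hx⟩, fun hx => hx.2⟩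
    exact Metric.closedBall_subset_closedBall (hM ⟨s, rfl⟩)
      (spectrum.subset_closedBall_norm_mul (𝕜 := ℝ) (g s) hx)
  rw [e]
  refine IsCompact.image (IsCompact.inter_right
    (isCompact_univ.prod (isCompact_closedBall _ _)) ?_) continuous_snd
  refine (Units.isOpen.preimage ?_).isClosed_compl
  have := continuous_algebraMap ℝ (H →L[ℂ] H)
  fun_prop

/-- No spectrum along the path contains `±ε`, so a single function, continuous on the union of all
the spectra, yields every projection. -/
theorem continuous_cfc_chi {g : I → H →L[ℂ] H} (hg : Continuous g) {ε : ℝ}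
    (hsa : ∀ s, IsSelfAdjoint (g s)) (h : ∀ s, Admissible (g s) ε) :
    Continuous fun s => cfc (chi (Set.Ioo (-ε) ε)) (g s) := by
  refine Continuous.cfc' (isCompact_iUnion_spectrum hg) _ hg
    (fun s => Set.subset_iUnion (fun s => spectrum ℝ (g s)) s) ?_ hsa
  refine continuousOn_indicator_of_isolated fun x hx hxs => ?_
  have hε := (h 0).pos
  rw [frontier_Ioo (by linarith)] at hx
  obtain ⟨s, hs⟩ := Set.mem_iUnion.1 hxs
  rcases hx with rfl | hx
  · exact absurd hs (h s).neg_notMem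
  · obtain rfl : x = ε := hx
    exact absurd hs (h s).notMem

/-- The restriction of a path to `[0, t]`. -/
def initialPath {X : Type*} [TopologicalSpace X] (f : C(I, X)) (t : I) : Path (f 0) (f t) where
  toFun s := f (t * s)
  continuous_toFun := by fun_prop
  source' := by simp
  target' := by simp

/-- The value of `μ` on `f|[0,t]` followed by the path from `f t` to `f t + 1_{0}(f t)`. -/
def partialFlow (μ : Omega (BFsaStar H) (GBFsaStar H) → ℤ)
    (f : Omega (BFsaStar H) (GBFsaStar H)) (t : I) : ℤ :=
  μ (.ofPath ((initialPath f.1 t).trans (seg (f.1 t) (addKer (f.1 t)) (finRank_addKer_sub _)))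
    f.2.1 (addKer_mem _))

variable {μ : Omega (BFsaStar H) (GBFsaStar H) → ℤ}

theorem addKer_eq_self {T : BFsaStar H} (hT : T ∈ GBFsaStar H) : (addKer T).1 = T.1 := by
  have : cfc (chi {0}) T.1 = 0 := by
    rw [← cfc_zero ℝ T.1]
    refine cfc_congr fun x hx => ?_
    have : x ∉ ({0} : Set ℝ) := by
      rintro rfl
      exact spectrum.zero_notMem ℝ hT hx
    simp only [chi, Set.indicator_of_notMem this, Pi.zero_apply]
  change T.1 + cfc (chi {0}) T.1 = T.1
  rw [this, add_zero]

theorem seg_addKer_mem {T : BFsaStar H} (hT : T ∈ GBFsaStar H) (t : I) :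
    seg T (addKer T) (finRank_addKer_sub T) t ∈ GBFsaStar H := by
  change IsUnit (lineOp T.1 (addKer T).1 t)
  rw [addKer_eq_self hT, lineOp, sub_self, smul_zero, add_zero]
  exact hT

theorem partialFlow_zero (hc : SatisfiesConcatenation μ) (hh : SatisfiesHomotopy μ)
    (f : Omega (BFsaStar H) (GBFsaStar H)) : partialFlow μ f 0 = 0 := by
  refine mu_eq_zero_of_forall_mem hc hh _ fun t => ?_
  change Path.trans _ _ t ∈ _
  rw [Path.trans_apply]
  split_ifs
  · change f.1 (0 * _) ∈ _
    rw [zero_mul]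
    exact f.2.1
  · exact seg_addKer_mem f.2.1 _

theorem partialFlow_one (hc : SatisfiesConcatenation μ) (hh : SatisfiesHomotopy μ)
    (f : Omega (BFsaStar H) (GBFsaStar H)) : partialFlow μ f 1 = μ f := by
  rw [partialFlow, hc.ofPath_trans _ _ f.2.1 f.2.2 (addKer_mem _)]
  have h1 : μ (.ofPath (seg (f.1 1) (addKer (f.1 1)) (finRank_addKer_sub _)) f.2.2
      (addKer_mem _)) = 0 :=
    mu_eq_zero_of_forall_mem hc hh _ fun t => seg_addKer_mem f.2.2 t
  rw [h1, add_zero]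
  congr 1
  refine Omega.ext_apply fun t => ?_
  change f.1 (1 * t) = _
  rw [one_mul]

theorem FlowSubdivision.admissible {f : C(I, BFsaStar H)} (S : FlowSubdivision f) (j : Fin S.n)
    {s : I} (hs : s ∈ Set.Icc (S.t j.castSucc) (S.t j.succ)) : Admissible (f s).1 (S.ε j) := by
  refine ⟨S.ε_pos j, (S.notMem_spectrum j s hs).1, (S.notMem_spectrum j s hs).2, fun r hr => ?_⟩
  by_contra hn
  have := S.disjoint_essSpectrum j s hs
  exact Set.notMem_empty r (this ▸ ⟨hr, hn⟩)

theorem sum_fin_sub_castSucc (n : ℕ) (Ψ : Fin (n + 1) → ℤ) :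
    ∑ j : Fin n, (Ψ j.succ - Ψ j.castSucc) = Ψ (Fin.last n) - Ψ 0 := by
  induction n with
  | zero => simp
  | succ n ih =>
    rw [Fin.sum_univ_castSucc]
    have := ih fun i => Ψ i.castSucc
    simp only [← Fin.succ_castSucc] at this
    rw [this]
    simp

/-- With `Q` the kernel projection of `f t₀`, the operator `f t - r + Q` is invertible for `(t, r)`
near `(t₀, 0)`, and removing the finite-rank `Q` leaves a Fredholm operator. The points `±ε` are
chosen off the spectrum at `t₀`, which is an open condition in `t`. -/
theorem exists_eventually_admissible (f : C(I, BFsaStar H)) (t₀ : I) :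
    ∃ ε, ∀ᶠ t in 𝓝 t₀, Admissible (f t).1 ε := by
  have hQ := finRank_cfc_chi_singleton (f t₀)
  set Q := cfc (chi {0}) (f t₀).1 with hQdef
  have hcont : Continuous fun p : I × ℝ => (f p.1).1 - (p.2 : ℂ) • (1 : H →L[ℂ] H) + Q := by
    fun_prop
  have hu : IsUnit ((f t₀).1 - ((0 : ℝ) : ℂ) • (1 : H →L[ℂ] H) + Q) := by
    rw [Complex.ofReal_zero, zero_smul, sub_zero]
    exact addKer_mem (f t₀)
  have hev : ∀ᶠ p in 𝓝 (t₀, (0 : ℝ)),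
      IsUnit ((f p.1).1 - (p.2 : ℂ) • (1 : H →L[ℂ] H) + Q) :=
    hcont.continuousAt.eventually (Units.isOpen.mem_nhds hu)
  rw [nhds_prod_eq] at hev
  obtain ⟨p, hp, q, hq, hpq⟩ := Filter.eventually_prod_iff.1 hev
  obtain ⟨δ, hδ, hq⟩ := Metric.eventually_nhds_iff.1 hq
  have hs := eventually_notMem_spectrum (f t₀).2.1 (f t₀).2.2.1
  have hs' : ∀ᶠ r : ℝ in 𝓝[≠] 0, -r ∉ spectrum ℝ (f t₀).1 := by
    have : Filter.Tendsto (fun r : ℝ => -r) (𝓝[≠] 0) (𝓝[≠] 0) := by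
      refine tendsto_nhdsWithin_of_tendsto_nhds_of_eventually_within _ ?_ ?_
      · have := (continuous_neg (G := ℝ)).tendsto 0
        rw [neg_zero] at this
        exact this.mono_left nhdsWithin_le_nhds
      · filter_upwards [self_mem_nhdsWithin] with x hx
        simpa using hx
    exact this.eventually hs
  have hle : 𝓝[>] (0 : ℝ) ≤ 𝓝[≠] 0 := nhdsWithin_mono _ fun x hx => ne_of_gt hx
  obtain ⟨ε, ⟨⟨hε1, hε2⟩, hε0⟩, hεδ⟩ := (((hs.filter_mono hle).and (hs'.filter_mono hle)).and
    self_mem_nhdsWithin).and (Ioo_mem_nhdsGT hδ) |>.exists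
  have hopen : ∀ r : ℝ, r ∉ spectrum ℝ (f t₀).1 → ∀ᶠ t in 𝓝 t₀, r ∉ spectrum ℝ (f t).1 := by
    intro r hr
    rw [spectrum.notMem_iff] at hr
    have hcr : Continuous fun t => algebraMap ℝ (H →L[ℂ] H) r - (f t).1 := by fun_prop
    filter_upwards [hcr.continuousAt.eventually (Units.isOpen.mem_nhds hr)] with t ht
    rw [spectrum.notMem_iff]
    exact ht
  refine ⟨ε, ?_⟩
  filter_upwards [hp, hopen ε hε1, hopen (-ε) hε2] with t ht h1 h2
  refine ⟨hε0, h1, h2, fun r hr => ?_⟩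
  have hr' : q r := hq (by
    rw [Real.dist_eq, sub_zero]
    exact (abs_le.2 hr).trans_lt hεδ.2)
  have := isFredholm_add_of_finRank (isFredholm_of_isUnit (hpq ht hr')) hQ.neg
  rwa [add_neg_cancel_right] at this

theorem nonempty_flowSubdivision (f : C(I, BFsaStar H)) : Nonempty (FlowSubdivision f) := by
  choose ε hε using exists_eventually_admissible f
  -- A Lebesgue number for the cover by admissible neighbourhoods allows equal steps of length `1 /
  -- (n + 1) < δ`, each step using the `ε` of a set containing it.
  obtain ⟨δ, hδ, hball⟩ := lebesgue_number_lemma_of_metric (s := (Set.univ : Set I))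
    (c := fun t₀ => interior {t | Admissible (f t).1 (ε t₀)}) isCompact_univ
    (fun _ => isOpen_interior)
    (fun t _ => Set.mem_iUnion.2 ⟨t, mem_interior_iff_mem_nhds.2 (hε t)⟩)
  choose c hc using fun t => hball t trivial
  obtain ⟨n, hn⟩ := exists_nat_one_div_lt hδ
  have hn0 : (0 : ℝ) < n + 1 := by positivity
  let t : Fin (n + 1 + 1) → I := fun i => ⟨(i : ℕ) / (n + 1 : ℝ), by positivity, by
    rw [div_le_one hn0]
    exact_mod_cast Nat.lt_succ_iff.1 i.2⟩
  have hadm : ∀ (j : Fin (n + 1)), ∀ s ∈ Set.Icc (t j.castSucc) (t j.succ),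
      Admissible (f s).1 (ε (c (t j.castSucc))) := by
    intro j s hs
    have h1 : s ∈ Metric.ball (t j.castSucc) δ := by
      rw [Metric.mem_ball, Subtype.dist_eq, Real.dist_eq]
      have h1 : (t j.castSucc : ℝ) ≤ s := hs.1
      have h2 : (s : ℝ) ≤ t j.succ := hs.2
      have h3 : (t j.succ : ℝ) = t j.castSucc + 1 / (n + 1) := by
        simp [t, add_div]
      rw [abs_of_nonneg (sub_nonneg.2 h1)]
      linarith
    exact (interior_subset (hc (t j.castSucc) h1) :
      s ∈ {x : I | Admissible (f x).1 (ε (c (t j.castSucc)))})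
  refine ⟨⟨n + 1, t, ?_, ?_, ?_, fun j => ε (c (t j.castSucc)), fun j => ?_, fun j s hs => ?_,
    fun j s hs => ?_⟩⟩
  · intro i j hij
    change ((i : ℕ) : ℝ) / (n + 1) < ((j : ℕ) : ℝ) / (n + 1)
    have : ((i : ℕ) : ℝ) < ((j : ℕ) : ℝ) := by exact_mod_cast hij
    gcongr
  · ext1; simp [t]
  · ext1; simp [t, hn0.ne']
  · exact (hadm j _ (Set.left_mem_Icc.2 (by
      change ((j.castSucc : ℕ) : ℝ) / (n + 1) ≤ ((j.succ : ℕ) : ℝ) / (n + 1)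
      gcongr
      simp))).pos
  · exact ⟨(hadm j s hs).notMem, (hadm j s hs).neg_notMem⟩
  · rw [Set.eq_empty_iff_forall_notMem]
    rintro r ⟨hr, hr'⟩
    exact hr' ((hadm j s hs).isFredholm r hr)

variable [TopologicalSpace.SeparableSpace H]

theorem partialFlow_sub (hc : SatisfiesConcatenation μ) (hh : SatisfiesHomotopy μ)
    (hn : SatisfiesNormalization μ) (f : Omega (BFsaStar H) (GBFsaStar H)) {a b : I} (hab : a ≤ b)
    {ε : ℝ} (h : ∀ s ∈ Set.Icc a b, Admissible (f.1 s).1 ε) :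
    partialFlow μ f b - partialFlow μ f a =
      (spectralRank (f.1 b).1 ε : ℤ) - spectralRank (f.1 a).1 ε := by
  have hmem : ∀ s : I, (a : ℝ) ≤ a + s * (b - a) ∧ (a : ℝ) + s * (b - a) ≤ b := by
    intro s
    have h1 : (0 : ℝ) ≤ b - a := sub_nonneg.2 hab
    constructor
    · nlinarith [s.2.1]
    · nlinarith [s.2.2]
  let θ : I → I := fun s => ⟨a + s * (b - a), a.2.1.trans (hmem s).1, (hmem s).2.trans b.2.2⟩
  have hθ : Continuous θ := by
    refine Continuous.subtype_mk ?_ _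
    fun_prop
  have hθ0 : θ 0 = a := by ext1; simp [θ]
  have hθ1 : θ 1 = b := by ext1; simp [θ]
  have hadm : ∀ s, Admissible (f.1 (θ s)).1 ε := fun s => h _ ⟨(hmem s).1, (hmem s).2⟩
  have hgc : Continuous fun s => (f.1 (θ s)).1 := by fun_prop
  have hE := continuous_cfc_chi hgc (fun s => (f.1 (θ s)).2.1) hadm
  have hrank := finrank_range_eq_of_continuous hE
    (fun s => (isStarProjection_cfc_chi (hadm s).continuousOn_chi).isIdempotentElem.eq)
    (fun s => (hadm s).finRank) 0 1
  rw [← spectralRank_add_negRank _ (hadm 0), ← spectralRank_add_negRank _ (hadm 1)] at hrank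
  -- The paths completed through `pushUp` vary continuously with `s` and keep invertible endpoints,
  -- since `1_{(-ε, ε)}` does. The ones completed through `addKer` need not vary continuously,
  -- because the kernel dimension can jump.
  have hμ : μ (.ofPath ((initialPath f.1 (θ 0)).trans (seg (f.1 (θ 0)) (pushUp _ (hadm 0))
        (finRank_pushUp_sub _ _))) f.2.1 (pushUp_mem _ _)) =
      μ (.ofPath ((initialPath f.1 (θ 1)).trans (seg (f.1 (θ 1)) (pushUp _ (hadm 1))
        (finRank_pushUp_sub _ _))) f.2.1 (pushUp_mem _ _)) := by
    have hcont := Path.trans_continuous_family (fun s => initialPath f.1 (θ s)) (by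
        change Continuous fun p : I × I => f.1 (θ p.1 * p.2)
        fun_prop)
      (fun s => seg (f.1 (θ s)) (pushUp _ (hadm s)) (finRank_pushUp_sub _ _)) (by
        refine Continuous.subtype_mk ?_ _
        have : Continuous fun s => (pushUp (f.1 (θ s)) (hadm s)).1 := by
          have hc2 : Continuous fun _ : I => ((2 * ε : ℝ) : ℂ) := continuous_const
          exact hgc.add (hc2.smul hE)
        unfold lineOp
        exact (hgc.comp continuous_fst).add ((Complex.continuous_ofReal.comp
          (continuous_subtype_val.comp continuous_snd)).smul
          ((this.comp continuous_fst).sub (hgc.comp continuous_fst))))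
    refine hh _ _ ⟨⟨_, hcont⟩, fun t => rfl, fun t => rfl, fun s => ⟨?_, ?_⟩⟩
    · change Path.trans _ _ 0 ∈ _
      rw [Path.source]
      exact f.2.1
    · change Path.trans _ _ 1 ∈ _
      rw [Path.target]
      exact pushUp_mem _ _
  rw [mu_trans_pushUp hc hh hn f.2.1 _ (hadm 0), mu_trans_pushUp hc hh hn f.2.1 _ (hadm 1)] at hμ
  change partialFlow μ f (θ 0) + _ = partialFlow μ f (θ 1) + _ at hμ
  rw [hθ0, hθ1] at hμ hrank
  have : (spectralRank (f.1 a).1 ε : ℤ) + negRank (f.1 a).1 ε =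
    spectralRank (f.1 b).1 ε + negRank (f.1 b).1 ε := by exact_mod_cast hrank
  linarith

theorem mu_eq_flow (hc : SatisfiesConcatenation μ) (hh : SatisfiesHomotopy μ)
    (hn : SatisfiesNormalization μ) (f : Omega (BFsaStar H) (GBFsaStar H))
    (S : FlowSubdivision f.1) : μ f = S.flow := by
  have h := sum_fin_sub_castSucc S.n fun j => partialFlow μ f (S.t j)
  rw [S.t_last, S.t_zero, partialFlow_zero hc hh, partialFlow_one hc hh, sub_zero] at h
  rw [← h, FlowSubdivision.flow]
  refine Finset.sum_congr rfl fun j _ => ?_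
  exact partialFlow_sub hc hh hn f (S.strictMono.monotone j.castSucc_lt_succ.le)
    fun s hs => S.admissible j hs

end Main

end SpectralFlow

end

/-- Every subdivision yields the value `μ f`, so independence of the subdivision comes out together
with uniqueness. -/
theorem mainTheorem9 {H : Type*} [NormedAddCommGroup H] [InnerProductSpace ℂ H] [CompleteSpace H]
    [TopologicalSpace.SeparableSpace H] (hH : ¬ FiniteDimensional ℂ H)
    (μ : SpectralFlow.Omega (SpectralFlow.BFsaStar H) (SpectralFlow.GBFsaStar H) → ℤ)
    (hconcat : SpectralFlow.SatisfiesConcatenation μ)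
    (hhomotopy : SpectralFlow.SatisfiesHomotopy μ)
    (hnorm : SpectralFlow.SatisfiesNormalization μ)
    (f : SpectralFlow.Omega (SpectralFlow.BFsaStar H) (SpectralFlow.GBFsaStar H)) :
    Nonempty (SpectralFlow.FlowSubdivision f.1) ∧
      (∀ S : SpectralFlow.FlowSubdivision f.1, S.flow = SpectralFlow.spectralFlow f.1) ∧
      μ f = SpectralFlow.spectralFlow f.1 := by
  have key := SpectralFlow.mu_eq_flow hconcat hhomotopy hnorm f
  have hne := SpectralFlow.nonempty_flowSubdivision f.1
  have hsf : SpectralFlow.spectralFlow f.1 = μ f := by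
    rw [SpectralFlow.spectralFlow, dif_pos hne, key]
  exact ⟨hne, fun S => by rw [hsf, key S], hsf.symm⟩
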